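/- Throughout, all spaces are complex Banach spaces, $B_Z$ and $S_Z$ are the open unit ball and the unit sphere of a Banach space $Z$, $\mathcal H^\infty(B_Y,Z)$ is the space of bounded holomorphic functions $B_Y\to Z$ with the supremum norm, and $\mathcal H^\infty(B_X)=\mathcal H^\infty(B_X,\mathbb C)$, a Banach algebra. Let $\mathcal M_\infty(B_X,B_Y)$ be the set of non-null algebra homomorphisms $\Phi:\mathcal H^\infty(B_X)\to\mathcal H^\infty(B_Y)$. For $g\in\mathcal H^\infty(B_Y,X^{**})$ the fiber over $g$ is $$\mathscr F(g)=\{\Phi\in\mathcal M_\infty(B_X,B_Y):\ \Phi(x^*|_{B_X})(y)=g(y)(x^*)\ \text{ for all } y\in B_Y,\ x^*\in X^*\}.$$ For $f\in\mathcal H^\infty(B_X)$ let $\widetilde f$ be its canonical (Aron--Berner) extension to $B_{X^{**}}$: $\widetilde f(z)=\sum_{m\ge 0}\widetilde A_m(z,\dots,z)$, where $A_m=\frac1{m!}D^mf(0)$ and $\widetilde A_m$ is the extension of the symmetric $m$-linear form $A_m$ to $X^{**}$ obtained by extending weak-star continuously in one variable after the other. If $g(B_Y)\subset B_{X^{**}}$,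 then $C_g$ denotes the composition homomorphism $C_g(f)=\widetilde f\circ g$, and $C_{\mathbf 0}$ is that of the constant function $0$. For $\Phi,\Psi\in\mathcal M_\infty(B_X,B_Y)$ put $$\sigma(\Phi,\Psi)=\sup_{y\in B_Y}\sup\{|\Phi(f)(y)|:\ f\in\mathcal H^\infty(B_X),\ \|f\|\le1,\ \Psi(f)(y)=0\},$$ and let $\mathcal{GP}(\Phi)=\{\Psi\in\mathcal M_\infty(B_X,B_Y):\ \|\Phi-\Psi\|<2\}$ (operator norm) be the Gleason part of $\Phi$. Proposition. Let $X$ and $Y$ be Banach spaces. (a) For every $g\in\mathcal H^\infty(B_Y,X^{**})$ with $\|g\|<1$, the maps $C_g$ and $C_{\mathbf 0}$ are well-defined elements of $\mathcal M_\infty(B_X,B_Y)$, $C_g\in\mathcal{GP}(C_{\mathbf 0})$, and $\sigma(C_g,C_{\mathbf 0})=\|g\|$. (b) Let $g,h\in\mathcal H^\infty(B_Y,X^{**})$ with $\|g\|=1$ and $\|h\|<1$. Then any $\Phi\in\mathscr F(g)$ and $\Psi\in\mathscr F(h)$ lie in different Gleason parts, i.e. $\mathcal{GP}(\Phi)\cap\mathcal{GP}(\Psi)=\varnothing$.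 (c) Let $g,h\in\mathcal H^\infty(B_Y,X^{**})$ with $g(B_Y)\subset B_{X^{**}}$ and $h(B_Y)\subset S_{X^{**}}$. Then any $\Phi\in\mathscr F(g)$ and $\Psi\in\mathscr F(h)$ lie in different Gleason parts, i.e. $\mathcal{GP}(\Phi)\cap\mathcal{GP}(\Psi)=\varnothing$. -/

import Mathlib

open Metric Set
open scoped ENNReal BoundedContinuousFunction

noncomputable section

namespace GleasonParts

/-- The open unit ball `B_X` of a normed space. -/
abbrev UnitBall (X : Type*) [NormedAddCommGroup X] : Set X := ball (0 : X) 1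

/-- The extension by zero to all of `X` of a function on `B_X`. -/
def zeroExt {X E : Type*} [NormedAddCommGroup X] [NormedAddCommGroup E]
    (f : UnitBall X → E) : X → E :=
  Function.extend Subtype.val f 0

theorem zeroExt_apply {X E : Type*} [NormedAddCommGroup X] [NormedAddCommGroup E]
    (f : UnitBall X → E) {x : X} (hx : x ∈ UnitBall X) : zeroExt f x = f ⟨x, hx⟩ :=
  Subtype.val_injective.extend_apply f 0 ⟨x, hx⟩

/-- A function on `B_X` is holomorphic if around every point of `B_X` it is the sum of a
convergent power series of continuous homogeneous polynomials. -/
def IsHolomorphic {X E : Type*} [NormedAddCommGroup X] [NormedSpace ℂ X]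
    [NormedAddCommGroup E] [NormedSpace ℂ E] (f : UnitBall X → E) : Prop :=
  AnalyticOnNhd ℂ (zeroExt f) (UnitBall X)

theorem isHolomorphic_of_eqOn {X E : Type*} [NormedAddCommGroup X] [NormedSpace ℂ X]
    [NormedAddCommGroup E] [NormedSpace ℂ E] {f : UnitBall X → E} {F : X → E}
    (hF : AnalyticOnNhd ℂ F (UnitBall X)) (h : ∀ x : UnitBall X, f x = F x) :
    IsHolomorphic f :=
  hF.congr isOpen_ball fun x hx => by rw [zeroExt_apply f hx, h]

/-- `H^∞(B_X, E)`: the bounded holomorphic functions `B_X → E`, with the supremum norm. -/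
def HInftyVec (X E : Type*) [NormedAddCommGroup X] [NormedSpace ℂ X]
    [NormedAddCommGroup E] [NormedSpace ℂ E] : Submodule ℂ (UnitBall X →ᵇ E) where
  carrier := {f | IsHolomorphic (f : UnitBall X → E)}
  zero_mem' := isHolomorphic_of_eqOn (F := fun _ => (0 : E)) analyticOnNhd_const fun _ => rfl
  add_mem' := fun {f g} hf hg =>
    isHolomorphic_of_eqOn (F := fun x => zeroExt f x + zeroExt g x) (AnalyticOnNhd.add hf hg)
      fun x => by simp [zeroExt_apply _ x.2]
  smul_mem' := fun c f hf =>
    isHolomorphic_of_eqOn (F := fun x => c • zeroExt f x)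
      (AnalyticOnNhd.smul analyticOnNhd_const hf)
      fun x => by simp [zeroExt_apply _ x.2]

/-- `H^∞(B_X)`: the algebra of bounded holomorphic functions `B_X → ℂ`, with the supremum
norm. -/
def HInfty (X : Type*) [NormedAddCommGroup X] [NormedSpace ℂ X] :
    Subalgebra ℂ (UnitBall X →ᵇ ℂ) where
  carrier := {f | IsHolomorphic (f : UnitBall X → ℂ)}
  add_mem' := fun {f g} hf hg =>
    isHolomorphic_of_eqOn (F := fun x => zeroExt f x + zeroExt g x) (AnalyticOnNhd.add hf hg)
      fun x => by simp [zeroExt_apply _ x.2]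
  mul_mem' := fun {f g} hf hg =>
    isHolomorphic_of_eqOn (F := fun x => zeroExt f x * zeroExt g x) (AnalyticOnNhd.mul hf hg)
      fun x => by simp [zeroExt_apply _ x.2]
  algebraMap_mem' := fun c =>
    isHolomorphic_of_eqOn (F := fun _ => c) analyticOnNhd_const fun _ => rfl

/-- The bidual `X**`. -/
abbrev Bidual (X : Type*) [NormedAddCommGroup X] [NormedSpace ℂ X] : Type _ :=
  StrongDual ℂ (StrongDual ℂ X)

/-- The restriction to `B_X` of a functional `x* ∈ X*`, as an element of `H^∞(B_X)`. -/
def dualToHInfty {X : Type*} [NormedAddCommGroup X] [NormedSpace ℂ X]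
    (l : StrongDual ℂ X) : HInfty X :=
  ⟨BoundedContinuousFunction.ofNormedAddCommGroup (fun x : UnitBall X => l x)
      (by fun_prop) ‖l‖ fun x => by
        have hx : ‖(x : X)‖ ≤ 1 := (mem_ball_zero_iff.1 x.2).le
        simpa using (l.le_opNorm (x : X)).trans (mul_le_of_le_one_right (norm_nonneg l) hx),
    isHolomorphic_of_eqOn (F := fun x => l x) (fun x _ => l.analyticAt x) fun _ => rfl⟩

/-- The vector-valued spectrum `M_∞(B_X, B_Y)`: all non-null algebra homomorphisms
`H^∞(B_X) → H^∞(B_Y)` (not assumed unital or continuous). -/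
abbrev VectorSpectrum (X Y : Type*) [NormedAddCommGroup X] [NormedSpace ℂ X]
    [NormedAddCommGroup Y] [NormedSpace ℂ Y] : Type _ :=
  {Φ : HInfty X →ₙₐ[ℂ] HInfty Y // Φ ≠ 0}

/-- The value `Φ(f)(y)`. -/
def VectorSpectrum.val {X Y : Type*} [NormedAddCommGroup X] [NormedSpace ℂ X]
    [NormedAddCommGroup Y] [NormedSpace ℂ Y] (Φ : VectorSpectrum X Y) (f : HInfty X)
    (y : UnitBall Y) : ℂ :=
  (Φ.1 f).1 y

/-- The fiber over `g`: all `Φ` whose projection `y ↦ [x* ↦ Φ(x*)(y)]` equals `g`. -/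
def fiber {X Y : Type*} [NormedAddCommGroup X] [NormedSpace ℂ X]
    [NormedAddCommGroup Y] [NormedSpace ℂ Y] (g : HInftyVec Y (Bidual X)) :
    Set (VectorSpectrum X Y) :=
  {Φ | ∀ (y : UnitBall Y) (l : StrongDual ℂ X), Φ.val (dualToHInfty l) y = g.1 y l}

/-- The Aron-Berner extension of `m`-linear forms, evaluated on the diagonal: for a continuous
`m`-linear form `A` on `X` this is `Ã(z, …, z)`, where every slot of `A`, one after the other, is
extended to `X**` by `Ã(z, …) = z (x ↦ Ã(x, …))` (that is, by an iterated weak-star limit). -/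
def aronBernerDiag {X : Type*} [NormedAddCommGroup X] [NormedSpace ℂ X] (z : Bidual X) :
    (m : ℕ) → ContinuousMultilinearMap ℂ (fun _ : Fin m => X) ℂ →L[ℂ] ℂ
  | 0 => ContinuousMultilinearMap.apply ℂ (fun _ : Fin 0 => X) ℂ 0
  | m + 1 =>
      z ∘L (ContinuousLinearMap.compL ℂ X (ContinuousMultilinearMap ℂ (fun _ : Fin m => X) ℂ) ℂ
          (aronBernerDiag z m)) ∘L
        (continuousMultilinearCurryLeftEquiv ℂ
          (fun _ : Fin (m + 1) => X) ℂ).toContinuousLinearEquiv.toContinuousLinearMap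

/-- The extension to `X**`, evaluated at `z`, of the `m`-homogeneous Taylor polynomial
of `f` at `0`. The symmetric `m`-linear form of that polynomial is `D^m f(0) / m!`. -/
def taylorExt {X : Type*} [NormedAddCommGroup X] [NormedSpace ℂ X] (f : HInfty X)
    (z : Bidual X) (m : ℕ) : ℂ :=
  aronBernerDiag z m ((m.factorial : ℂ)⁻¹ • iteratedFDeriv ℂ m (zeroExt f.1) 0)

/-- `w` is the value at `z` of the canonical extension of `f` to the ball of `X**`, i.e.
the series of the extended Taylor polynomials of `f` at `0` converges at `z` to `w`. -/
def IsCanonicalExtValue {X : Type*} [NormedAddCommGroup X] [NormedSpace ℂ X] (f : HInfty X)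
    (z : Bidual X) (w : ℂ) : Prop :=
  HasSum (taylorExt f z) w

/-- `Φ` is the composition homomorphism `C_g`, i.e. `Φ(f) = f̃ ∘ g` for all `f`. -/
def IsCompositionHom {X Y : Type*} [NormedAddCommGroup X] [NormedSpace ℂ X]
    [NormedAddCommGroup Y] [NormedSpace ℂ Y] (g : HInftyVec Y (Bidual X))
    (Φ : VectorSpectrum X Y) : Prop :=
  ∀ (f : HInfty X) (y : UnitBall Y), IsCanonicalExtValue f (g.1 y) (Φ.val f y)

/-- The operator norm `‖Φ - Ψ‖`, as a supremum over the closed unit ball of `H^∞(B_X)`. -/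
def gleasonDist {X Y : Type*} [NormedAddCommGroup X] [NormedSpace ℂ X]
    [NormedAddCommGroup Y] [NormedSpace ℂ Y] (Φ Ψ : VectorSpectrum X Y) : ℝ≥0∞ :=
  ⨆ (f : HInfty X) (_ : ‖f‖ ≤ 1), ‖Φ.1 f - Ψ.1 f‖ₑ

/-- The Gleason part of `Φ`: all `Ψ` with `‖Φ - Ψ‖ < 2`. -/
def gleasonPart {X Y : Type*} [NormedAddCommGroup X] [NormedSpace ℂ X]
    [NormedAddCommGroup Y] [NormedSpace ℂ Y] (Φ : VectorSpectrum X Y) :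
    Set (VectorSpectrum X Y) :=
  {Ψ | gleasonDist Φ Ψ < 2}

/-- The pseudo-hyperbolic distance
`ρ(φ, ψ) = sup {|φ(f)| : ‖f‖ ≤ 1, ψ(f) = 0}` of two functionals on `H^∞(B_X)`. -/
def pseudoHypDist {X : Type*} [NormedAddCommGroup X] [NormedSpace ℂ X]
    (φ ψ : HInfty X → ℂ) : ℝ≥0∞ :=
  ⨆ (f : HInfty X) (_ : ‖f‖ ≤ 1) (_ : ψ f = 0), ‖φ f‖ₑ

/-- `σ(Φ, Ψ) = sup_{y ∈ B_Y} ρ(δ_y ∘ Φ, δ_y ∘ Ψ)`. -/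
def sigmaDist {X Y : Type*} [NormedAddCommGroup X] [NormedSpace ℂ X]
    [NormedAddCommGroup Y] [NormedSpace ℂ Y] (Φ Ψ : VectorSpectrum X Y) : ℝ≥0∞ :=
  ⨆ y : UnitBall Y, pseudoHypDist (fun f => Φ.val f y) (fun f => Ψ.val f y)

end GleasonParts

end

/-! Parts (b) and (c) rest on a transfer principle: if two characters of `H^∞(B_X)` satisfy `‖φ - θ‖
≤ 2 - ε`, a function in the unit ball that is nearly unimodular at `φ` is nearly unimodular at `θ`,
with constants depending only on `ε` and the tolerance. Otherwise a high power of a rotate of it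
would be near `1` at `φ` and near `0` at `θ`, and a Möbius map sending `1` to `1` and `0` close to
`-1` would push the distance above `2 - ε`. Applied to the characters `f ↦ Φ(f)(y)`, uniformly in
`y`, and to functionals `x*` nearly norming a value of the bidual-valued map, this separates the
fibers.

For (a), let `D` send `f` to `x ↦ z (fderiv f x)`. The Taylor terms of the canonical extension at
`z` are `D^m f(0) / m!`. As `D` is a derivation, the Leibniz rule turns products into Cauchy
products, so the extension is multiplicative wherever the series converges absolutely.

Convergence needs the Aron-Berner extension of a homogeneous polynomial `P` to have norm at most
that of `P`. Here this comes from the Euler scheme `(1 + D/N)^N P`. One step replaces a value by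
that of an affine function extended to the bidual, which preserves bounds up to `O(1/N²)`, so `N`
steps from the unit ball down to `0` lose only `O(1/N)`. At `0` only the term of degree `m`
survives, and it tends to `D^m P(0) / m!`.

Characters are contractive and the extension is analytic, so the Schwarz lemma gives `|f̃(z) - f(0)|
≤ M‖z‖`, where `M` bounds `|f - f(0)|`. With `M = 2` and `M = 1` this yields the Gleason part and
the upper bound for `σ`; functionals give the lower bound. -/

noncomputable section

namespace GleasonParts

/-! ### Cauchy estimates and sums of analytic functions on normed spaces -/

section Analytic

variable {E F : Type*} [NormedAddCommGroup E] [NormedSpace ℂ E]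
  [NormedAddCommGroup F] [NormedSpace ℂ F]

/-- Schwarz lemma; the factor `2` arises because values are compared with `f c` rather than `0`. -/
theorem norm_fderiv_le_of_forall_mem_ball {f : E → F} {c : E} {r M : ℝ} (hr : 0 < r)
    (hf : DifferentiableOn ℂ f (ball c r)) (hM : ∀ y ∈ ball c r, ‖f y‖ ≤ M) :
    ‖fderiv ℂ f c‖ ≤ 2 * M / r := by
  refine Complex.norm_fderiv_le_div_of_mapsTo_ball hf (fun y hy => ?_) hr
  rw [mem_closedBall, dist_eq_norm]
  linarith [norm_sub_le (f y) (f c), hM y hy, hM c (mem_ball_self hr)]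

/-- Each differentiation uses up a layer of width `δ` and costs a factor `2 / δ`. -/
theorem norm_iteratedFDeriv_le_of_forall_mem_ball [CompleteSpace F] {f : E → F} {δ M : ℝ}
    (hδ : 0 < δ) (n : ℕ) : ∀ c : E, AnalyticOnNhd ℂ f (ball c ((n + 1) * δ)) →
    (∀ y ∈ ball c ((n + 1) * δ), ‖f y‖ ≤ M) → ‖iteratedFDeriv ℂ n f c‖ ≤ M * (2 / δ) ^ n := by
  induction n with
  | zero =>
    intro c _ hM
    simpa using hM c (mem_ball_self (by positivity))
  | succ n ih =>
    intro c hf hM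
    have hsub : ∀ y ∈ ball c δ, ball y ((n + 1) * δ) ⊆ ball c (((n + 1 : ℕ) + 1) * δ) := by
      intro y hy
      refine ball_subset_ball' ?_
      push_cast
      linarith [mem_ball.1 hy]
    rw [← norm_fderiv_iteratedFDeriv]
    have h := norm_fderiv_le_of_forall_mem_ball (f := iteratedFDeriv ℂ n f) (c := c) hδ
      (M := M * (2 / δ) ^ n)
      (((hf.iteratedFDeriv n).mono (ball_subset_ball (by push_cast; nlinarith))).differentiableOn)
      (fun y hy => ih y (hf.mono (hsub y hy)) fun w hw => hM w (hsub y hy hw))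
    refine h.trans_eq ?_
    rw [pow_succ]
    ring

theorem iteratedDeriv_comp_line [CompleteSpace F] {f : E → F} {s : Set E} (hs : IsOpen s)
    (hf : AnalyticOnNhd ℂ f s) (c v : E) (n : ℕ) : ∀ ζ : ℂ, c + ζ • v ∈ s →
    iteratedDeriv n (fun ζ : ℂ => f (c + ζ • v)) ζ
      = iteratedFDeriv ℂ n f (c + ζ • v) fun _ => v := by
  induction n with
  | zero => intro ζ _; simp
  | succ n ih =>
    intro ζ hζ
    have hline : HasDerivAt (fun ζ : ℂ => c + ζ • v) v ζ := by
      simpa using ((hasDerivAt_id ζ).smul_const v).const_add c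
    have hev : iteratedDeriv n (fun ζ : ℂ => f (c + ζ • v)) =ᶠ[nhds ζ]
        fun ζ => iteratedFDeriv ℂ n f (c + ζ • v) fun _ => v := by
      filter_upwards [hline.continuousAt.preimage_mem_nhds (hs.mem_nhds hζ)] with w hw
      exact ih w hw
    rw [iteratedDeriv_succ, hev.deriv_eq, iteratedFDeriv_succ_apply_left]
    have h1 := ((hf.iteratedFDeriv n) _ hζ).differentiableAt.hasFDerivAt.comp_hasDerivAt ζ hline
    exact ((ContinuousMultilinearMap.apply ℂ (fun _ : Fin n => E) F
      fun _ => v).hasFDerivAt.comp_hasDerivAt ζ h1).deriv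

theorem differentiableOn_comp_line {f : E → F} {s : Set E} (hf : DifferentiableOn ℂ f s)
    (c v : E) : DifferentiableOn ℂ (fun ζ : ℂ => f (c + ζ • v)) {ζ | c + ζ • v ∈ s} :=
  hf.comp (by fun_prop) fun _ h => h

/-- The Taylor series of an analytic function on a ball converges on the whole ball. -/
theorem hasSum_iteratedFDeriv_of_mem_ball [CompleteSpace F] {f : E → F} {c : E} {r : ℝ}
    (hf : AnalyticOnNhd ℂ f (ball c r)) {v : E} (hv : ‖v‖ < r) :
    HasSum (fun n : ℕ => ((n.factorial : ℂ)⁻¹ • iteratedFDeriv ℂ n f c) fun _ => v)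
      (f (c + v)) := by
  -- Restricting to the line through `c` and `c + v` reduces to one variable; `R > 1` puts the
  -- parameter `1` inside the disc.
  obtain ⟨R, hR1, hR⟩ : ∃ R : ℝ, 1 < R ∧ R * ‖v‖ < r := by
    have h : ∀ᶠ R : ℝ in nhdsWithin 1 (Ioi 1), R * ‖v‖ < r :=
      ((continuous_id.mul continuous_const).tendsto' (1 : ℝ) ‖v‖ (by simp)
        |>.mono_left nhdsWithin_le_nhds).eventually_lt_const hv
    exact ((eventually_mem_nhdsWithin.and h).exists)
  have hd : DifferentiableOn ℂ (fun ζ : ℂ => f (c + ζ • v)) (ball 0 R) :=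
    (differentiableOn_comp_line hf.differentiableOn c v).mono fun ζ hζ => by
      have : ‖ζ‖ * ‖v‖ ≤ R * ‖v‖ :=
        mul_le_mul_of_nonneg_right (mem_ball_zero_iff.1 hζ).le (norm_nonneg v)
      simpa [norm_smul] using this.trans_lt hR
  have h := Complex.hasSum_taylorSeries_on_ball hd (z := 1) (by simpa using hR1)
  have hc : c + (0 : ℂ) • v ∈ ball c r := by simpa using (norm_nonneg v).trans_lt hv
  simpa [iteratedDeriv_comp_line isOpen_ball hf c v _ 0 hc] using h

/-- Split the radius into `n + 1` equal layers; then `(n + 1)^n / n! ≤ e^(n + 1)` keeps the growth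
geometric. -/
theorem norm_taylorCoeff_le [CompleteSpace F] {f : E → F} {c : E} {r M : ℝ} (hr : 0 < r)
    (hf : AnalyticOnNhd ℂ f (ball c r)) (hM : ∀ y ∈ ball c r, ‖f y‖ ≤ M) (n : ℕ) :
    ‖(n.factorial : ℂ)⁻¹ • iteratedFDeriv ℂ n f c‖
      ≤ M * Real.exp 1 * (2 * Real.exp 1 / r) ^ n := by
  have hn : (0 : ℝ) < n + 1 := by positivity
  have hM0 : 0 ≤ M := (norm_nonneg _).trans (hM c (mem_ball_self hr))
  have e : ((n : ℝ) + 1) * (r / (n + 1)) = r := by field_simp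
  have h := norm_iteratedFDeriv_le_of_forall_mem_ball (f := f) (M := M) (δ := r / (n + 1))
    (by positivity) n c (by rwa [e]) (by rwa [e])
  have h2 := Real.pow_div_factorial_le_exp (x := (n : ℝ) + 1) hn.le n
  have h3 : (2 / (r / ((n : ℝ) + 1))) ^ n = (2 / r) ^ n * ((n : ℝ) + 1) ^ n := by
    rw [← mul_pow]; congr 1; field_simp
  rw [norm_smul, norm_inv, Complex.norm_natCast]
  calc _ ≤ ((n.factorial : ℝ))⁻¹ * (M * (2 / (r / (n + 1))) ^ n) := by gcongr
    _ = M * (2 / r) ^ n * (((n : ℝ) + 1) ^ n / n.factorial) := by rw [h3]; ring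
    _ ≤ M * (2 / r) ^ n * Real.exp (n + 1) := by gcongr
    _ = _ := by
      rw [Real.exp_add, ← mul_one (n : ℝ), Real.exp_nat_mul, div_pow, div_pow, mul_pow]
      ring

/-- The sum of a series of analytic functions on a ball, dominated by a summable series of
constants, is analytic at the center. -/
theorem analyticAt_tsum [CompleteSpace F] {t : ℕ → E → F} {a : ℕ → ℝ} {c : E} {r : ℝ}
    (hr : 0 < r) (ht : ∀ m, AnalyticOnNhd ℂ (t m) (ball c r)) (ha : Summable a)
    (hta : ∀ m, ∀ y ∈ ball c r, ‖t m y‖ ≤ a m) :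
    AnalyticAt ℂ (fun y => ∑' m, t m y) c := by
  have ha0 : ∀ m, 0 ≤ a m := fun m => (norm_nonneg _).trans (hta m c (mem_ball_self hr))
  set K : ℝ := 2 * Real.exp 1 / r with hK
  have hK0 : 0 < K := by positivity
  let q : ℕ → FormalMultilinearSeries ℂ E F := fun m n =>
    (n.factorial : ℂ)⁻¹ • iteratedFDeriv ℂ n (t m) c
  have hq : ∀ m n, ‖q m n‖ ≤ a m * Real.exp 1 * K ^ n := fun m n =>
    norm_taylorCoeff_le hr (ht m) (hta m) n
  have hqs : ∀ n, Summable fun m => q m n := fun n =>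
    Summable.of_norm_bounded ((ha.mul_right _).mul_right _) fun m => hq m n
  let p : FormalMultilinearSeries ℂ E F := fun n => ∑' m, q m n
  have hp : ∀ n, ‖p n‖ ≤ (∑' m, a m) * Real.exp 1 * K ^ n := fun n =>
    tsum_of_norm_bounded ((ha.hasSum.mul_right _).mul_right _) fun m => hq m n
  -- The bound `1 / (2K)` forces ratio at most `1/2` in the expansion index, so the double series
  -- converges absolutely and may be summed in either order.
  have hρ : 0 < min r (1 / (2 * K)) := by positivity
  obtain ⟨ρ, hρe⟩ : ∃ ρ : NNReal, (ρ : ℝ) = min r (1 / (2 * K)) := ⟨⟨_, hρ.le⟩, rfl⟩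
  have hKρ : K * ρ ≤ 1 / 2 := by
    rw [hρe]
    calc K * min r (1 / (2 * K)) ≤ K * (1 / (2 * K)) := by gcongr; exact min_le_right _ _
      _ = 1 / 2 := by field_simp
  have hS : 0 ≤ (∑' m, a m) * Real.exp 1 := mul_nonneg (tsum_nonneg ha0) (Real.exp_pos 1).le
  refine HasFPowerSeriesOnBall.analyticAt (p := p) (r := ρ) ⟨?_, ?_, fun {v} hv => ?_⟩
  · refine p.le_radius_of_bound ((∑' m, a m) * Real.exp 1) fun n => ?_
    calc ‖p n‖ * (ρ : ℝ) ^ n ≤ (∑' m, a m) * Real.exp 1 * K ^ n * (ρ : ℝ) ^ n := by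
          gcongr; exact hp n
      _ = (∑' m, a m) * Real.exp 1 * (K * ρ) ^ n := by rw [mul_pow]; ring
      _ ≤ (∑' m, a m) * Real.exp 1 := mul_le_of_le_one_right hS
          (pow_le_one₀ (by positivity) (hKρ.trans (by norm_num)))
  · rw [ENNReal.coe_pos, ← NNReal.coe_pos, hρe]
    exact hρ
  · have hvρ : ‖v‖ < ρ := by simpa [Metric.eball_coe] using hv
    have hvr : ‖v‖ < r := hvρ.trans_le (hρe ▸ min_le_left _ _)
    have hterm : ∀ m n, ‖q m n fun _ => v‖ ≤ a m * (Real.exp 1 * (1 / 2) ^ n) := fun m n => by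
      have h1 := (q m n).le_opNorm fun _ => v
      rw [Finset.prod_const, Finset.card_univ, Fintype.card_fin] at h1
      calc _ ≤ a m * Real.exp 1 * K ^ n * (ρ : ℝ) ^ n := by
            refine h1.trans (mul_le_mul (hq m n) ?_ (by positivity) ?_)
            · exact pow_le_pow_left₀ (norm_nonneg v) hvρ.le n
            · have := ha0 m; positivity
        _ = a m * (Real.exp 1 * (K * ρ) ^ n) := by rw [mul_pow]; ring
        _ ≤ _ := by have := ha0 m; gcongr
    have hsum : Summable fun i : ℕ × ℕ => q i.1 i.2 fun _ => v :=
      Summable.of_norm_bounded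
        (ha.mul_of_nonneg ((summable_geometric_of_lt_one (by norm_num)
          (by norm_num : (1 / 2 : ℝ) < 1)).mul_left (Real.exp 1)) ha0 fun n => by positivity)
        fun i => hterm i.1 i.2
    have hfib : ∀ m, HasSum (fun n => q m n fun _ => v) (t m (c + v)) := fun m =>
      hasSum_iteratedFDeriv_of_mem_ball (ht m) hvr
    have htot : ∑' i : ℕ × ℕ, (q i.1 i.2 fun _ => v) = ∑' m, t m (c + v) :=
      (hsum.hasSum.prod_fiberwise hfib).tsum_eq.symm
    have hev : ∀ n, HasSum (fun m => q m n fun _ => v) (p n fun _ => v) := fun n =>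
      ContinuousMultilinearMap.hasSum_eval (hqs n).hasSum fun _ => v
    have hsymm : HasSum (fun i : ℕ × ℕ => q i.2 i.1 fun _ => v) (∑' m, t m (c + v)) := by
      rw [← htot]
      exact (Equiv.prodComm ℕ ℕ).hasSum_iff (f := fun i : ℕ × ℕ => q i.1 i.2 fun _ => v) |>.2
        hsum.hasSum
    exact hsymm.prod_fiberwise hev

end Analytic

/-! ### Characters of `H^∞(B_X)` -/

section Characters

variable {X Y : Type*} [NormedAddCommGroup X] [NormedSpace ℂ X]
  [NormedAddCommGroup Y] [NormedSpace ℂ Y]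

theorem HInfty.norm_apply_le (f : HInfty X) (x : UnitBall X) : ‖f.1 x‖ ≤ ‖f‖ :=
  f.1.norm_coe_le_norm x

theorem HInfty.norm_le {f : HInfty X} {C : ℝ} (hC : 0 ≤ C) (h : ∀ x, ‖f.1 x‖ ≤ C) : ‖f‖ ≤ C :=
  (BoundedContinuousFunction.norm_le hC).2 h

theorem HInfty.ext {f g : HInfty X} (h : ∀ x, f.1 x = g.1 x) : f = g :=
  Subtype.ext (BoundedContinuousFunction.ext h)

theorem HInfty.exists_mul_eq_one (f : HInfty X) {δ : ℝ} (hδ : 0 < δ)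
    (hf : ∀ x, δ ≤ ‖f.1 x‖) : ∃ g : HInfty X, f * g = 1 := by
  have h0 : ∀ x, f.1 x ≠ 0 := fun x => norm_pos_iff.1 (hδ.trans_le (hf x))
  refine ⟨⟨BoundedContinuousFunction.ofNormedAddCommGroup (fun x => (f.1 x)⁻¹)
    (f.1.continuous.inv₀ h0) δ⁻¹ fun x => ?_, ?_⟩, HInfty.ext fun x => mul_inv_cancel₀ (h0 x)⟩
  · rw [norm_inv]
    exact inv_anti₀ hδ (hf x)
  · refine isHolomorphic_of_eqOn (F := fun x => (zeroExt f.1 x)⁻¹) (fun x hx => ?_) fun x => ?_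
    · refine (f.2 x hx).inv ?_
      rw [zeroExt_apply _ hx]
      exact h0 _
    · simp [zeroExt_apply _ x.2]

theorem HInfty.algHom_smul (φ : HInfty X →ₐ[ℂ] ℂ) (c : ℂ) (f : HInfty X) :
    φ (c • f) = c * φ f :=
  φ.toLinearMap.map_smul c f

/-- If `|φ f| > ‖f‖`, then `φ f - f` is bounded away from zero, hence invertible, yet `φ` kills it.
-/
theorem HInfty.norm_algHom_le (φ : HInfty X →ₐ[ℂ] ℂ) (f : HInfty X) : ‖φ f‖ ≤ ‖f‖ := by
  by_contra! hlt
  obtain ⟨g, hg⟩ := HInfty.exists_mul_eq_one (algebraMap ℂ (HInfty X) (φ f) - f)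
    (sub_pos.2 hlt) fun x => by
      have h1 : ‖φ f‖ - ‖f.1 x‖ ≤ ‖φ f - f.1 x‖ := norm_sub_norm_le _ _
      have h2 := HInfty.norm_apply_le f x
      exact (by linarith : ‖φ f‖ - ‖f‖ ≤ ‖φ f - f.1 x‖)
  have h := congrArg φ hg
  rw [map_mul, map_sub, AlgHom.commutes] at h
  simp at h

/-- The difference of the squares is `(1 - w²)(1 - |a|²)`. -/
theorem norm_sub_le_norm_one_sub_mul {w : ℝ} (hw0 : 0 ≤ w) (hw : w < 1) {a : ℂ} (ha : ‖a‖ ≤ 1) :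
    ‖a - w‖ ≤ ‖1 - w * a‖ := by
  have h1 : a.re * a.re + a.im * a.im ≤ 1 := by
    rw [← Complex.normSq_apply, Complex.normSq_eq_norm_sq]
    exact pow_le_one₀ (norm_nonneg a) ha
  refine (sq_le_sq₀ (norm_nonneg _) (norm_nonneg _)).1 ?_
  rw [← Complex.normSq_eq_norm_sq, ← Complex.normSq_eq_norm_sq, Complex.normSq_apply,
    Complex.normSq_apply]
  simp
  have hw2 : 0 ≤ 1 - w * w := by nlinarith
  nlinarith [mul_nonneg hw2 (sub_nonneg.2 h1)]

/-- Composition with the Möbius transformation `a ↦ (a - w) / (1 - w a)` of the disc. -/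
theorem HInfty.exists_mobius {w : ℝ} (hw0 : 0 ≤ w) (hw : w < 1) (f : HInfty X) (hf : ‖f‖ ≤ 1) :
    ∃ g : HInfty X, ‖g‖ ≤ 1 ∧
      ∀ φ : HInfty X →ₐ[ℂ] ℂ, φ g = (φ f - w) / (1 - w * φ f) := by
  have hpos : ∀ a : ℂ, ‖a‖ ≤ 1 → 1 - w ≤ ‖1 - (w : ℂ) * a‖ := fun a ha => by
    have h1 := norm_sub_norm_le (1 : ℂ) (w * a)
    rw [norm_one, norm_mul, Complex.norm_real, Real.norm_of_nonneg hw0] at h1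
    nlinarith
  obtain ⟨k, hk⟩ := HInfty.exists_mul_eq_one (1 - (w : ℂ) • f) (sub_pos.2 hw)
    fun x => hpos (f.1 x) ((HInfty.norm_apply_le f x).trans hf)
  have hφ : ∀ φ : HInfty X →ₐ[ℂ] ℂ,
      φ ((f - algebraMap ℂ _ (w : ℂ)) * k) = (φ f - w) / (1 - w * φ f) := fun φ => by
    have h := congrArg φ hk
    rw [map_mul, map_sub, map_one, HInfty.algHom_smul] at h
    have h2 : φ k = (1 - w * φ f)⁻¹ := (inv_eq_of_mul_eq_one_right h).symm
    rw [map_mul, map_sub, AlgHom.commutes, h2]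
    rfl
  refine ⟨(f - algebraMap ℂ _ (w : ℂ)) * k, HInfty.norm_le zero_le_one fun x => ?_, hφ⟩
  have hx : ‖f.1 x‖ ≤ 1 := (HInfty.norm_apply_le f x).trans hf
  have h1 : (1 - (w : ℂ) * f.1 x) * k.1 x = 1 := congrArg (fun k : HInfty X => k.1 x) hk
  have h2 : k.1 x = (1 - w * f.1 x)⁻¹ := (inv_eq_of_mul_eq_one_right h1).symm
  change ‖(f.1 x - w) * k.1 x‖ ≤ 1
  rw [h2, ← div_eq_mul_inv, norm_div]
  exact div_le_one_of_le₀ (norm_sub_le_norm_one_sub_mul hw0 hw hx) (norm_nonneg _)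

/-- If two characters are at distance less than `2`, then a function in the unit ball which is
almost unimodular at the first one is almost unimodular at the second one. -/
theorem HInfty.exists_norm_gt_of_norm_sub_le {ε η : ℝ} (hε : 0 < ε) (hη : 0 < η) :
    ∃ δ > 0, ∀ φ θ : HInfty X →ₐ[ℂ] ℂ, (∀ g : HInfty X, ‖g‖ ≤ 1 → ‖φ g - θ g‖ ≤ 2 - ε) →
      ∀ f : HInfty X, ‖f‖ ≤ 1 → 1 - δ < ‖φ f‖ → 1 - η < ‖θ f‖ := by
  wlog hε1 : ε ≤ 1 generalizing ε
  · obtain ⟨δ, hδ, h⟩ := this (ε := 1) one_pos le_rfl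
    exact ⟨δ, hδ, fun φ θ hφθ => h φ θ fun g hg => (hφθ g hg).trans (by linarith)⟩
  -- With this `w`, `T 1 = 1` and `T 0 = -w` are `2 - ε/4` apart, so errors of `ε/4` at both ends
  -- still contradict `2 - ε`.
  set w : ℝ := 1 - ε / 4 with hwdef
  have hw0 : 0 ≤ w := by linarith
  have hw1 : w < 1 := by linarith
  have hwc : (1 : ℂ) - w ≠ 0 := by exact_mod_cast (sub_pos.2 hw1).ne'
  let T : ℂ → ℂ := fun a => (a - w) / (1 - w * a)
  have hT0 : ContinuousAt T 0 := ContinuousAt.div (by fun_prop) (by fun_prop) (by simp)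
  have hT1 : ContinuousAt T 1 := ContinuousAt.div (by fun_prop) (by fun_prop) (by simpa using hwc)
  obtain ⟨r₀, hr₀, h0⟩ := Metric.continuousAt_iff.1 hT0 (ε / 4) (by positivity)
  obtain ⟨r₁, hr₁, h1⟩ := Metric.continuousAt_iff.1 hT1 (ε / 4) (by positivity)
  -- The power `n` is fixed before `δ`, and neither depends on the characters. The maximum covers `η
  -- > 1`.
  obtain ⟨n, hn⟩ : ∃ n : ℕ, max (1 - η) 0 ^ n < r₀ :=
    exists_pow_lt_of_lt_one hr₀ (max_lt (by linarith) one_pos)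
  obtain ⟨δ, hδ, h2⟩ := Metric.continuousAt_iff.1
    (by fun_prop : ContinuousAt (fun a : ℂ => a ^ n) 1) r₁ hr₁
  refine ⟨δ, hδ, fun φ θ hφθ f hf hφf => ?_⟩
  by_contra! hθ
  obtain ⟨u, hu, huf⟩ : ∃ u : ℂ, ‖u‖ = 1 ∧ u * φ f = (‖φ f‖ : ℂ) := by
    rcases eq_or_ne (φ f) 0 with h | h
    · exact ⟨1, by simp, by simp [h]⟩
    · have : (‖φ f‖ : ℂ) ≠ 0 := by simpa using h
      exact ⟨‖φ f‖ / φ f, by simp [h], div_mul_cancel₀ _ h⟩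
  have hF : ‖(u • f) ^ n‖ ≤ 1 := by
    have h3 : ‖u • f‖ ≤ 1 := by rw [norm_smul, hu, one_mul]; exact hf
    refine HInfty.norm_le zero_le_one fun x => ?_
    change ‖(u • f).1 x ^ n‖ ≤ 1
    rw [norm_pow]
    exact pow_le_one₀ (norm_nonneg _) ((HInfty.norm_apply_le _ x).trans h3)
  obtain ⟨g, hg, hgφ⟩ := HInfty.exists_mobius hw0 hw1 _ hF
  have hφ1 : ‖φ f‖ ≤ 1 := (HInfty.norm_algHom_le φ f).trans hf
  have ha : dist (T (φ ((u • f) ^ n))) (T 1) < ε / 4 := by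
    refine h1 ?_
    rw [map_pow, HInfty.algHom_smul, huf, ← one_pow n]
    simp only [one_pow] at h2 ⊢
    refine h2 ?_
    rw [dist_eq_norm, ← Complex.ofReal_one, ← Complex.ofReal_sub, Complex.norm_real,
      Real.norm_eq_abs, abs_lt]
    constructor <;> linarith
  have hb : dist (T (θ ((u • f) ^ n))) (T 0) < ε / 4 := by
    refine h0 ?_
    rw [map_pow, HInfty.algHom_smul, dist_zero_right, norm_pow, norm_mul, hu, one_mul]
    exact (pow_le_pow_left₀ (norm_nonneg _) (hθ.trans (le_max_left _ _)) n).trans_lt hn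
  have hT : dist (T 1) (T 0) = 2 - ε / 4 := by
    have e : T 1 - T 0 = ((1 + w : ℝ) : ℂ) := by
      simp only [T, mul_one, mul_zero, zero_sub, sub_zero, div_one, div_self hwc]
      push_cast; ring
    rw [dist_eq_norm, e, Complex.norm_real, Real.norm_of_nonneg (by linarith)]
    linarith
  have hfin := hφθ g hg
  rw [hgφ φ, hgφ θ, ← dist_eq_norm] at hfin
  change dist (T _) (T _) ≤ _ at hfin
  have h4 := dist_triangle4 (T 1) (T (φ ((u • f) ^ n))) (T (θ ((u • f) ^ n))) (T 0)
  rw [dist_comm (T 1) (T (φ _))] at h4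
  linarith

end Characters

/-! ### Evaluations of the vector-valued spectrum -/

section Spectrum

variable {X Y : Type*} [NormedAddCommGroup X] [NormedSpace ℂ X]
  [NormedAddCommGroup Y] [NormedSpace ℂ Y]

/-- An idempotent takes only the values `0` and `1`, and the ball is connected. -/
theorem HInfty.eq_zero_of_mul_self {e : HInfty Y} (he : e * e = e) {y : UnitBall Y}
    (hy : e.1 y = 0) : e = 0 := by
  have hsq : ∀ x, e.1 x = 0 ∨ e.1 x = 1 := fun x => by
    have h : e.1 x * e.1 x = e.1 x := congrArg (fun k : HInfty Y => k.1 x) he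
    rcases eq_or_ne (e.1 x) 0 with h0 | h0
    · exact .inl h0
    · exact .inr (mul_left_cancel₀ h0 (by rw [h, mul_one]))
  have : PreconnectedSpace (UnitBall Y) :=
    Subtype.preconnectedSpace (convex_ball (0 : Y) 1).isPreconnected
  have hopen : IsOpen {x : UnitBall Y | e.1 x = 0} := by
    have : {x : UnitBall Y | e.1 x = 0} = e.1 ⁻¹' {1}ᶜ := by
      ext x
      rcases hsq x with h | h <;> simp [h]
    rw [this]
    exact isOpen_compl_singleton.preimage e.1.continuous
  have hclopen : IsClopen {x : UnitBall Y | e.1 x = 0} :=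
    ⟨isClosed_singleton.preimage e.1.continuous, hopen⟩
  have huniv := hclopen.eq_univ ⟨y, hy⟩
  exact HInfty.ext fun x => (huniv ▸ mem_univ x : x ∈ {x : UnitBall Y | e.1 x = 0})

/-- `Φ 1` is idempotent; if it vanished at one point it would vanish identically, and so would `Φ`.
-/
theorem VectorSpectrum.val_one (Φ : VectorSpectrum X Y) (y : UnitBall Y) : Φ.val 1 y = 1 := by
  have he : Φ.1 1 * Φ.1 1 = Φ.1 1 := by rw [← map_mul, one_mul]
  have h : Φ.val 1 y * Φ.val 1 y = Φ.val 1 y := congrArg (fun k : HInfty Y => k.1 y) he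
  rcases eq_or_ne (Φ.val 1 y) 0 with h0 | h0
  · refine absurd (NonUnitalAlgHom.ext fun f => ?_) Φ.2
    rw [← one_mul f, map_mul, HInfty.eq_zero_of_mul_self he h0, zero_mul]
    rfl
  · exact mul_left_cancel₀ h0 (by rw [h, mul_one])

/-- The character `f ↦ Φ(f)(y)` of `H^∞(B_X)`. -/
def VectorSpectrum.eval (Φ : VectorSpectrum X Y) (y : UnitBall Y) : HInfty X →ₐ[ℂ] ℂ :=
  AlgHom.ofLinearMap
    { toFun := fun f => Φ.val f y
      map_add' := fun f g => by simp only [VectorSpectrum.val, map_add]; rfl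
      map_smul' := fun c f => by simp only [VectorSpectrum.val, map_smul]; rfl }
    (Φ.val_one y) fun f g => by
      change Φ.val (f * g) y = Φ.val f y * Φ.val g y
      simp only [VectorSpectrum.val, map_mul]; rfl

theorem exists_norm_sub_le_of_mem_gleasonPart {Φ Θ : VectorSpectrum X Y}
    (h : Θ ∈ gleasonPart Φ) : ∃ ε > 0, ∀ (y : UnitBall Y) (f : HInfty X), ‖f‖ ≤ 1 →
      ‖Φ.val f y - Θ.val f y‖ ≤ 2 - ε := by
  have hlt : gleasonDist Φ Θ < 2 := h
  have htop : gleasonDist Φ Θ ≠ ⊤ := (hlt.trans ENNReal.ofNat_lt_top).ne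
  have h2 : (gleasonDist Φ Θ).toReal < 2 := by
    simpa using (ENNReal.toReal_lt_toReal htop ENNReal.ofNat_ne_top).2 hlt
  refine ⟨2 - (gleasonDist Φ Θ).toReal, sub_pos.2 h2, fun y f hf => ?_⟩
  have h3 : ‖Φ.1 f - Θ.1 f‖ₑ ≤ gleasonDist Φ Θ :=
    le_iSup₂ (f := fun (f : HInfty X) (_ : ‖f‖ ≤ 1) => ‖Φ.1 f - Θ.1 f‖ₑ) f hf
  have h4 : ‖Φ.1 f - Θ.1 f‖ ≤ (gleasonDist Φ Θ).toReal :=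
    (toReal_enorm _).symm.trans_le (ENNReal.toReal_mono htop h3)
  have h5 : ‖Φ.val f y - Θ.val f y‖ ≤ ‖Φ.1 f - Θ.1 f‖ :=
    HInfty.norm_apply_le (Φ.1 f - Θ.1 f) y
  linarith

theorem gleasonDist_comm (Φ Ψ : VectorSpectrum X Y) : gleasonDist Φ Ψ = gleasonDist Ψ Φ := by
  simp only [gleasonDist]
  refine iSup_congr fun f => iSup_congr fun _ => ?_
  rw [← enorm_neg, neg_sub]

/-- If the Gleason parts of `Φ` and `Ψ` meet, then functions in the unit ball that are almost
unimodular under `Φ` are so under `Ψ`, uniformly in the point of evaluation. -/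
theorem exists_norm_val_gt_of_not_disjoint {Φ Ψ : VectorSpectrum X Y}
    (h : ¬ Disjoint (gleasonPart Φ) (gleasonPart Ψ)) {η : ℝ} (hη : 0 < η) :
    ∃ δ > 0, ∀ (y : UnitBall Y) (f : HInfty X), ‖f‖ ≤ 1 → 1 - δ < ‖Φ.val f y‖ →
      1 - η < ‖Ψ.val f y‖ := by
  -- Transferring from `Φ` to `Θ` and then to `Ψ` avoids any appeal to transitivity of the Gleason
  -- relation.
  obtain ⟨Θ, hΦ, hΨ⟩ := Set.not_disjoint_iff.1 h
  obtain ⟨ε₁, hε₁, h₁⟩ := exists_norm_sub_le_of_mem_gleasonPart hΦ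
  obtain ⟨ε₂, hε₂, h₂⟩ := exists_norm_sub_le_of_mem_gleasonPart
    (show Ψ ∈ gleasonPart Θ from (gleasonDist_comm Θ Ψ).trans_lt hΨ)
  obtain ⟨δ₂, hδ₂, H₂⟩ := HInfty.exists_norm_gt_of_norm_sub_le (X := X) hε₂ hη
  obtain ⟨δ₁, hδ₁, H₁⟩ := HInfty.exists_norm_gt_of_norm_sub_le (X := X) hε₁ hδ₂
  exact ⟨δ₁, hδ₁, fun y f hf hlt => H₂ (Θ.eval y) (Ψ.eval y) (h₂ y) f hf
    (H₁ (Φ.eval y) (Θ.eval y) (h₁ y) f hf hlt)⟩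

theorem norm_dualToHInfty_le (l : StrongDual ℂ X) : ‖dualToHInfty l‖ ≤ ‖l‖ :=
  HInfty.norm_le (norm_nonneg l) fun x =>
    (l.le_opNorm (x : X)).trans
      (mul_le_of_le_one_right (norm_nonneg l) (mem_ball_zero_iff.1 x.2).le)

theorem exists_norm_le_one_lt_norm_apply {z : Bidual X} {t : ℝ} (ht : t < ‖z‖) :
    ∃ l : StrongDual ℂ X, ‖l‖ ≤ 1 ∧ t < ‖z l‖ := by
  by_contra! H
  have ht0 : 0 ≤ t := by simpa using H 0 (by simp)
  exact ht.not_ge (z.opNorm_le_of_unit_norm ht0 fun l hl => H l hl.le)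

theorem disjoint_gleasonPart_of_norm_lt_one {g h : HInftyVec Y (Bidual X)} (hg : ‖g‖ = 1)
    (hh : ‖h‖ < 1) {Φ Ψ : VectorSpectrum X Y} (hΦ : Φ ∈ fiber g) (hΨ : Ψ ∈ fiber h) :
    Disjoint (gleasonPart Φ) (gleasonPart Ψ) := by
  by_contra hdis
  -- The tolerance `1 - ‖h‖` makes the transferred inequality read `‖h‖ < |h(y)(l)|`, which is
  -- absurd for `‖l‖ ≤ 1`.
  obtain ⟨δ, hδ, H⟩ := exists_norm_val_gt_of_not_disjoint hdis (sub_pos.2 hh)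
  obtain ⟨y, hy⟩ : ∃ y, 1 - δ < ‖g.1 y‖ := by
    by_contra! hle
    have h0 : 0 ≤ 1 - δ := (norm_nonneg (g.1 _)).trans (hle ⟨0, mem_ball_self one_pos⟩)
    have h1 : ‖g‖ ≤ 1 - δ := (BoundedContinuousFunction.norm_le h0).2 hle
    linarith
  obtain ⟨l, hl, hlt⟩ := exists_norm_le_one_lt_norm_apply hy
  have h1 := H y (dualToHInfty l) ((norm_dualToHInfty_le l).trans hl) (by rwa [hΦ y l])
  rw [hΨ y l] at h1
  have h2 : ‖h.1 y l‖ ≤ ‖h.1 y‖ * 1 := (h.1 y).le_of_opNorm_le_of_le le_rfl hl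
  have h3 : ‖h.1 y‖ ≤ ‖h‖ := h.1.norm_coe_le_norm y
  linarith

theorem disjoint_gleasonPart_of_ball_of_sphere {g h : HInftyVec Y (Bidual X)}
    {y : UnitBall Y} (hg : ‖g.1 y‖ < 1) (hh : ‖h.1 y‖ = 1) {Φ Ψ : VectorSpectrum X Y}
    (hΦ : Φ ∈ fiber g) (hΨ : Ψ ∈ fiber h) : Disjoint (gleasonPart Φ) (gleasonPart Ψ) := by
  -- The transfer must start from the fiber over `h`, where some functional is nearly unimodular at
  -- `y`.
  rw [disjoint_comm]
  by_contra hdis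
  obtain ⟨δ, hδ, H⟩ := exists_norm_val_gt_of_not_disjoint hdis (sub_pos.2 hg)
  obtain ⟨l, hl, hlt⟩ := exists_norm_le_one_lt_norm_apply (z := h.1 y) (t := 1 - δ) (by linarith)
  have h1 := H y (dualToHInfty l) ((norm_dualToHInfty_le l).trans hl) (by rwa [hΨ y l])
  rw [hΦ y l] at h1
  have h2 : ‖g.1 y l‖ ≤ ‖g.1 y‖ * 1 := (g.1 y).le_of_opNorm_le_of_le le_rfl hl
  linarith

end Spectrum

/-! ### Iterated directional derivatives in the direction of a point of the bidual -/

section Derivation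

variable {X : Type*} [NormedAddCommGroup X] [NormedSpace ℂ X]

theorem aronBernerDiag_succ_apply (z : Bidual X) (m : ℕ)
    (A : ContinuousMultilinearMap ℂ (fun _ : Fin (m + 1) => X) ℂ) :
    aronBernerDiag z (m + 1) A = z (aronBernerDiag z m ∘L A.curryLeft) := rfl

theorem aronBernerDiag_smul (c : ℂ) (z : Bidual X) (m : ℕ) :
    ∀ A : ContinuousMultilinearMap ℂ (fun _ : Fin m => X) ℂ,
      aronBernerDiag (c • z) m A = c ^ m * aronBernerDiag z m A := by
  induction m with
  | zero => intro A; simp [aronBernerDiag]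
  | succ m ih =>
    intro A
    have : aronBernerDiag (c • z) m ∘L A.curryLeft
        = c ^ m • (aronBernerDiag z m ∘L A.curryLeft) := by
      ext x
      exact ih _
    rw [aronBernerDiag_succ_apply, aronBernerDiag_succ_apply, this, map_smul,
      _root_.smul_apply, smul_eq_mul, smul_eq_mul, pow_succ]
    ring

/-- One step of the Aron-Berner extension: the form `A ↦ z (x ↦ T (A(x, ·)))`. -/
def aronBernerStep {m : ℕ} (z : Bidual X)
    (T : ContinuousMultilinearMap ℂ (fun _ : Fin m => X) ℂ →L[ℂ] ℂ) :
    ContinuousMultilinearMap ℂ (fun _ : Fin (m + 1) => X) ℂ →L[ℂ] ℂ :=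
  z ∘L (ContinuousLinearMap.compL ℂ X (ContinuousMultilinearMap ℂ (fun _ : Fin m => X) ℂ) ℂ T) ∘L
    (continuousMultilinearCurryLeftEquiv ℂ
      (fun _ : Fin (m + 1) => X) ℂ).toContinuousLinearEquiv.toContinuousLinearMap

theorem aronBernerStep_apply {m : ℕ} (z : Bidual X)
    (T : ContinuousMultilinearMap ℂ (fun _ : Fin m => X) ℂ →L[ℂ] ℂ)
    (A : ContinuousMultilinearMap ℂ (fun _ : Fin (m + 1) => X) ℂ) :
    aronBernerStep z T A = z (T ∘L A.curryLeft) := rfl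

theorem isBoundedBilinearMap_aronBernerStep (m : ℕ) :
    IsBoundedBilinearMap ℂ fun p : Bidual X ×
      (ContinuousMultilinearMap ℂ (fun _ : Fin m => X) ℂ →L[ℂ] ℂ) => aronBernerStep p.1 p.2 where
  add_left z w T := by ext A; rfl
  smul_left c z T := by ext A; rfl
  add_right z T S := by
    ext A
    exact z.map_add (T ∘L A.curryLeft) (S ∘L A.curryLeft)
  smul_right c z T := by
    ext A
    exact z.map_smul c (T ∘L A.curryLeft)
  bound := by
    refine ⟨1, one_pos, fun z T => ContinuousLinearMap.opNorm_le_bound _ (by positivity)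
      fun A => ?_⟩
    rw [aronBernerStep_apply, one_mul, mul_assoc]
    refine z.le_of_opNorm_le_of_le le_rfl ((T.opNorm_comp_le _).trans_eq ?_)
    rw [ContinuousMultilinearMap.curryLeft_norm]

theorem analyticAt_aronBernerDiag (m : ℕ)
    (A : ContinuousMultilinearMap ℂ (fun _ : Fin m => X) ℂ) (z₀ : Bidual X) :
    AnalyticAt ℂ (fun z => aronBernerDiag z m A) z₀ := by
  have h : ∀ m : ℕ, ContDiff ℂ ⊤ fun z : Bidual X => aronBernerDiag z m := by
    intro m
    induction m with
    | zero => exact contDiff_const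
    | succ m ih =>
      exact (IsBoundedBilinearMap.contDiff
        (G := ContinuousMultilinearMap ℂ (fun _ : Fin (m + 1) => X) ℂ →L[ℂ] ℂ)
        (isBoundedBilinearMap_aronBernerStep m)).comp (contDiff_id.prodMk ih)
  exact ((h m).clm_apply contDiff_const).contDiffAt.analyticAt

/-- The `n`-th derivative of `f` at `x`, extended to the bidual and evaluated at `(z, …, z)`. -/
def bidualDeriv (z : Bidual X) (n : ℕ) (f : X → ℂ) (x : X) : ℂ :=
  aronBernerDiag z n (iteratedFDeriv ℂ n f x)

theorem hasFDerivAt_bidualDeriv (z : Bidual X) (n : ℕ) {f : X → ℂ} {x : X}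
    (hf : AnalyticAt ℂ f x) :
    HasFDerivAt (bidualDeriv z n f)
      (aronBernerDiag z n ∘L fderiv ℂ (iteratedFDeriv ℂ n f) x) x :=
  (aronBernerDiag z n).hasFDerivAt.comp x
    ((hf.contDiffAt (n := ⊤)).differentiableAt_iteratedFDeriv
      (WithTop.coe_lt_top _)).hasFDerivAt

/-- The recursion for the extended form matches currying of the iterated derivative, so these are
iterates of a single first-order derivation. -/
theorem bidualDeriv_succ (z : Bidual X) (n : ℕ) {f : X → ℂ} {x : X} (hf : AnalyticAt ℂ f x) :
    bidualDeriv z (n + 1) f x = z (fderiv ℂ (bidualDeriv z n f) x) := by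
  rw [(hasFDerivAt_bidualDeriv z n hf).fderiv, bidualDeriv, iteratedFDeriv_succ_eq_comp_left]
  rw [aronBernerDiag_succ_apply]
  congr 2

theorem bidualDeriv_zero (z : Bidual X) (f : X → ℂ) (x : X) : bidualDeriv z 0 f x = f x := rfl

/-- The Leibniz rule for iterated derivatives in the direction of a point of the bidual. -/
theorem bidualDeriv_mul (z : Bidual X) {f g : X → ℂ} {s : Set X} (hs : IsOpen s)
    (hf : AnalyticOnNhd ℂ f s) (hg : AnalyticOnNhd ℂ g s) (n : ℕ) : ∀ x ∈ s,
    bidualDeriv z n (fun x => f x * g x) x = ∑ ij ∈ Finset.HasAntidiagonal.antidiagonal n,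
      (n.choose ij.1 : ℂ) * (bidualDeriv z ij.1 f x * bidualDeriv z ij.2 g x) := by
  induction n with
  | zero => intro x _; simp [bidualDeriv_zero]
  | succ n ih =>
    intro x hx
    have hev : bidualDeriv z n (fun x => f x * g x) =ᶠ[nhds x] fun x =>
        ∑ ij ∈ Finset.HasAntidiagonal.antidiagonal n,
          (n.choose ij.1 : ℂ) * (bidualDeriv z ij.1 f x * bidualDeriv z ij.2 g x) := by
      filter_upwards [hs.mem_nhds hx] with y hy using ih y hy
    have hF : ∀ i, HasFDerivAt (bidualDeriv z i f) (fderiv ℂ (bidualDeriv z i f) x) x := fun i =>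
      (hasFDerivAt_bidualDeriv z i (hf x hx)).differentiableAt.hasFDerivAt
    have hG : ∀ i, HasFDerivAt (bidualDeriv z i g) (fderiv ℂ (bidualDeriv z i g) x) x := fun i =>
      (hasFDerivAt_bidualDeriv z i (hg x hx)).differentiableAt.hasFDerivAt
    have hsum := HasFDerivAt.fun_sum (u := Finset.HasAntidiagonal.antidiagonal n) fun ij _ =>
      ((hF ij.1).fun_mul (hG ij.2)).const_mul (n.choose ij.1 : ℂ)
    rw [bidualDeriv_succ z n ((hf x hx).fun_mul (hg x hx)), hev.fderiv_eq, hsum.fderiv, map_sum,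
      Finset.sum_antidiagonal_choose_succ_mul
        (fun i j => bidualDeriv z i f x * bidualDeriv z j g x), ← Finset.sum_add_distrib]
    refine Finset.sum_congr rfl fun ij hij => ?_
    rw [map_smul, map_add, map_smul, map_smul, ← bidualDeriv_succ z _ (hf x hx),
      ← bidualDeriv_succ z _ (hg x hx), Nat.choose_symm_of_eq_add
        (Finset.HasAntidiagonal.mem_antidiagonal.1 hij).symm]
    simp only [smul_eq_mul]
    ring

theorem HInfty.analyticAt_zeroExt (f : HInfty X) : AnalyticAt ℂ (zeroExt f.1) 0 :=
  f.2 0 (mem_ball_self one_pos)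

theorem taylorExt_eq_bidualDeriv (f : HInfty X) (z : Bidual X) (m : ℕ) :
    taylorExt f z m = (m.factorial : ℂ)⁻¹ * bidualDeriv z m (zeroExt f.1) 0 :=
  (aronBernerDiag z m).map_smul _ _

theorem zeroExt_mul (f g : HInfty X) :
    zeroExt (f * g).1 = fun x => zeroExt f.1 x * zeroExt g.1 x := by
  funext x
  by_cases hx : x ∈ UnitBall X
  · simp only [zeroExt_apply _ hx]; rfl
  · have h : ∀ k : UnitBall X → ℂ, zeroExt k x = 0 := fun k =>
      Function.extend_apply' _ _ _ fun ⟨a, ha⟩ => hx (ha ▸ a.2)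
    simp [h]

theorem zeroExt_add (f g : HInfty X) :
    zeroExt (f + g).1 = zeroExt f.1 + zeroExt g.1 := by
  funext x
  by_cases hx : x ∈ UnitBall X
  · simp only [Pi.add_apply, zeroExt_apply _ hx]; rfl
  · have h : ∀ k : UnitBall X → ℂ, zeroExt k x = 0 := fun k =>
      Function.extend_apply' _ _ _ fun ⟨a, ha⟩ => hx (ha ▸ a.2)
    simp [h]

theorem zeroExt_smul (c : ℂ) (f : HInfty X) : zeroExt (c • f).1 = c • zeroExt f.1 := by
  funext x
  by_cases hx : x ∈ UnitBall X
  · simp only [Pi.smul_apply, zeroExt_apply _ hx]; rfl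
  · have h : ∀ k : UnitBall X → ℂ, zeroExt k x = 0 := fun k =>
      Function.extend_apply' _ _ _ fun ⟨a, ha⟩ => hx (ha ▸ a.2)
    simp [h]

/-- The Leibniz rule divided by `m!`: the binomial coefficients are absorbed by the factorials. -/
theorem taylorExt_mul (f g : HInfty X) (z : Bidual X) (m : ℕ) :
    taylorExt (f * g) z m
      = ∑ ij ∈ Finset.HasAntidiagonal.antidiagonal m, taylorExt f z ij.1 * taylorExt g z ij.2 := by
  rw [taylorExt_eq_bidualDeriv, zeroExt_mul, bidualDeriv_mul z isOpen_ball f.2 g.2 m 0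
    (mem_ball_self one_pos), Finset.mul_sum]
  refine Finset.sum_congr rfl fun ij hij => ?_
  rw [taylorExt_eq_bidualDeriv, taylorExt_eq_bidualDeriv, ← Finset.HasAntidiagonal.mem_antidiagonal.1 hij,
    Nat.choose_symm_add, Nat.add_choose, Nat.cast_div (Nat.factorial_mul_factorial_dvd_factorial_add _ _)
      (by exact_mod_cast (by positivity)), Nat.cast_mul]
  have h1 : ((ij.1 + ij.2).factorial : ℂ) ≠ 0 := by exact_mod_cast Nat.factorial_ne_zero _
  have h2 : (ij.1.factorial : ℂ) ≠ 0 := by exact_mod_cast Nat.factorial_ne_zero _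
  have h3 : (ij.2.factorial : ℂ) ≠ 0 := by exact_mod_cast Nat.factorial_ne_zero _
  field_simp

theorem taylorExt_add (f g : HInfty X) (z : Bidual X) (m : ℕ) :
    taylorExt (f + g) z m = taylorExt f z m + taylorExt g z m := by
  rw [taylorExt, zeroExt_add, iteratedFDeriv_add_apply (HInfty.analyticAt_zeroExt f).contDiffAt
    (HInfty.analyticAt_zeroExt g).contDiffAt, smul_add, map_add]
  rfl

theorem taylorExt_smul (c : ℂ) (f : HInfty X) (z : Bidual X) (m : ℕ) :
    taylorExt (c • f) z m = c * taylorExt f z m := by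
  rw [taylorExt, zeroExt_smul, iteratedFDeriv_const_smul_apply
    (HInfty.analyticAt_zeroExt f).contDiffAt, smul_comm, map_smul]
  rfl

theorem taylorExt_smul_bidual (c : ℂ) (f : HInfty X) (z : Bidual X) (m : ℕ) :
    taylorExt f (c • z) m = c ^ m * taylorExt f z m :=
  aronBernerDiag_smul c z m _

theorem taylorExt_zero_right (f : HInfty X) (z : Bidual X) :
    taylorExt f z 0 = f.1 ⟨0, mem_ball_self one_pos⟩ := by
  rw [taylorExt_eq_bidualDeriv, bidualDeriv_zero, zeroExt_apply f.1 (mem_ball_self one_pos)]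
  simp

end Derivation

/-! ### The norm of the Aron-Berner extension of a homogeneous polynomial -/

section AronBernerNorm

variable {X : Type*} [NormedAddCommGroup X] [NormedSpace ℂ X]

theorem exists_norm_eq_one_norm_add_mul (c b : ℂ) :
    ∃ u : ℂ, ‖u‖ = 1 ∧ ‖c + u * b‖ = ‖c‖ + ‖b‖ := by
  rcases eq_or_ne c 0 with rfl | hc
  · exact ⟨1, by simp, by simp⟩
  rcases eq_or_ne b 0 with rfl | hb
  · exact ⟨1, by simp, by simp⟩
  have hc' : (‖c‖ : ℂ) ≠ 0 := by simpa using hc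
  refine ⟨c / ‖c‖ * (‖b‖ / b), by simp [hc, hb], ?_⟩
  have e : c + c / ‖c‖ * (‖b‖ / b) * b = c / ‖c‖ * ((‖c‖ + ‖b‖ : ℝ) : ℂ) := by
    push_cast; field_simp
  rw [e, norm_mul, Complex.norm_real, Real.norm_of_nonneg (by positivity)]
  simp [hc]

/-- A bound for an affine function on a ball persists for its extension to the bidual. -/
theorem norm_add_mul_bidual_le {z : Bidual X} (hz : ‖z‖ ≤ 1) {c : ℂ} {l : StrongDual ℂ X}
    {s B : ℝ} (hs : 0 < s) (h : ∀ v, ‖v‖ ≤ s → ‖c + l v‖ ≤ B) : ‖c + s * z l‖ ≤ B := by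
  have hc : ‖c‖ ≤ B := by simpa using h 0 (by simpa using hs.le)
  have hl : ‖l‖ ≤ (B - ‖c‖) / s := by
    refine l.opNorm_le_of_unit_norm (div_nonneg (sub_nonneg.2 hc) hs.le) fun x hx => ?_
    -- Rotating the argument aligns the two terms, so the bound controls `‖c‖ + s‖l‖`, which passes
    -- to the bidual.
    obtain ⟨u, hu, hub⟩ := exists_norm_eq_one_norm_add_mul c (s * l x)
    have h1 := h ((u * s) • x) (by simp [norm_smul, hu, hx, abs_of_pos hs])
    rw [map_smul, smul_eq_mul, mul_assoc, hub, norm_mul, Complex.norm_real,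
      Real.norm_of_nonneg hs.le] at h1
    rw [le_div_iff₀ hs]
    linarith
  rw [le_div_iff₀ hs] at hl
  have hzl : ‖z l‖ ≤ 1 * ‖l‖ := z.le_of_opNorm_le hz l
  calc ‖c + s * z l‖ ≤ ‖c‖ + ‖(s : ℂ) * z l‖ := norm_add_le _ _
    _ = ‖c‖ + s * ‖z l‖ := by rw [norm_mul, Complex.norm_real, Real.norm_of_nonneg hs.le]
    _ ≤ ‖c‖ + s * ‖l‖ := by gcongr; linarith
    _ ≤ B := by linarith

/-- A sequence of functions, each of which is the derivative of the preceding one in the direction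
`z` of the bidual, with uniformly controlled first-order Taylor remainders on the unit ball. -/
structure IsDerivSeq (z : Bidual X) (C : ℝ) (F : ℕ → X → ℂ) : Prop where
  differentiable : ∀ j, Differentiable ℂ (F j)
  apply_fderiv : ∀ j x, z (fderiv ℂ (F j) x) = F (j + 1) x
  remainder : ∀ j x v, ‖x‖ ≤ 1 → ‖v‖ ≤ 1 →
    ‖F j (x + v) - F j x - fderiv ℂ (F j) x v‖ ≤ C * ‖v‖ ^ 2

/-- One Euler step of length `s` in the direction of a derivative sequence. -/
def eulerStep (s : ℝ) (F : ℕ → X → ℂ) : ℕ → X → ℂ := fun j x => F j x + s * F (j + 1) x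

theorem IsDerivSeq.eulerStep {z : Bidual X} {C s : ℝ} {F : ℕ → X → ℂ} (h : IsDerivSeq z C F)
    (hs : 0 ≤ s) : IsDerivSeq z ((1 + s) * C) (eulerStep s F) := by
  have hd : ∀ j x, HasFDerivAt (GleasonParts.eulerStep s F j)
      (fderiv ℂ (F j) x + (s : ℂ) • fderiv ℂ (F (j + 1)) x) x := fun j x =>
    (h.differentiable j x).hasFDerivAt.add
      ((h.differentiable (j + 1) x).hasFDerivAt.const_mul (s : ℂ))
  refine ⟨fun j x => (hd j x).differentiableAt, fun j x => ?_, fun j x v hx hv => ?_⟩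
  · rw [(hd j x).fderiv, map_add, map_smul, h.apply_fderiv, h.apply_fderiv]
    rfl
  · rw [(hd j x).fderiv]
    have e : GleasonParts.eulerStep s F j (x + v) - GleasonParts.eulerStep s F j x
        - (fderiv ℂ (F j) x + (s : ℂ) • fderiv ℂ (F (j + 1)) x) v
        = (F j (x + v) - F j x - fderiv ℂ (F j) x v)
          + s * (F (j + 1) (x + v) - F (j + 1) x - fderiv ℂ (F (j + 1)) x v) := by
      simp only [GleasonParts.eulerStep, _root_.add_apply, _root_.smul_apply, smul_eq_mul]
      ring
    rw [e]
    refine (norm_add_le _ _).trans ?_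
    rw [norm_mul, Complex.norm_real, Real.norm_of_nonneg hs]
    have h1 := h.remainder j x v hx hv
    have h2 := mul_le_mul_of_nonneg_left (h.remainder (j + 1) x v hx hv) hs
    linarith

/-- The first-order Taylor polynomial at `x` is within `C s²` of a value of `F 0` on the ball of
radius `r + s`; its affine bound then extends to `z`. -/
theorem IsDerivSeq.norm_eulerStep_le {z : Bidual X} (hz : ‖z‖ ≤ 1) {C s r B : ℝ}
    {F : ℕ → X → ℂ} (h : IsDerivSeq z C F) (hC : 0 ≤ C) (hs : 0 < s) (hr : 0 ≤ r)
    (hrs : r + s ≤ 1) (hB : ∀ x, ‖x‖ ≤ r + s → ‖F 0 x‖ ≤ B) {x : X} (hx : ‖x‖ ≤ r) :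
    ‖GleasonParts.eulerStep s F 0 x‖ ≤ B + C * s ^ 2 := by
  rw [GleasonParts.eulerStep, ← h.apply_fderiv]
  refine norm_add_mul_bidual_le hz hs fun v hv => ?_
  have h1 := h.remainder 0 x v (by linarith) (by linarith)
  have h2 := hB (x + v) ((norm_add_le _ _).trans (add_le_add hx hv))
  have h3 : C * ‖v‖ ^ 2 ≤ C * s ^ 2 := by gcongr
  calc ‖F 0 x + fderiv ℂ (F 0) x v‖
      = ‖F 0 (x + v) - (F 0 (x + v) - F 0 x - fderiv ℂ (F 0) x v)‖ := by congr 1; ring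
    _ ≤ _ := (norm_sub_le _ _).trans (by linarith)

theorem IsDerivSeq.iterate_eulerStep {z : Bidual X} {C s : ℝ} {F : ℕ → X → ℂ}
    (h : IsDerivSeq z C F) (hs : 0 ≤ s) (k : ℕ) :
    IsDerivSeq z ((1 + s) ^ k * C) ((GleasonParts.eulerStep s)^[k] F) := by
  induction k with
  | zero => simpa using h
  | succ k ih =>
    rw [Function.iterate_succ_apply', pow_succ', mul_assoc]
    exact ih.eulerStep hs

theorem IsDerivSeq.norm_iterate_eulerStep_le {z : Bidual X} (hz : ‖z‖ ≤ 1) {C M : ℝ}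
    {F : ℕ → X → ℂ} (h : IsDerivSeq z C F) (hC : 0 ≤ C) (hM : ∀ x, ‖x‖ ≤ 1 → ‖F 0 x‖ ≤ M)
    {N : ℕ} (hN : 0 < N) :
    ‖(GleasonParts.eulerStep (1 / N : ℝ))^[N] F 0 0‖ ≤ M + Real.exp 1 * C * (1 / N) := by
  have hN' : (0 : ℝ) < N := by exact_mod_cast hN
  set s : ℝ := 1 / N with hsdef
  have hs : 0 < s := by positivity
  have hNs : N * s = 1 := by rw [hsdef]; field_simp
  have hpow : ∀ k ≤ N, (1 + s) ^ k ≤ Real.exp 1 := fun k hk => by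
    calc (1 + s) ^ k ≤ Real.exp s ^ k := by
          gcongr; linarith [Real.add_one_le_exp s]
      _ = Real.exp (k * s) := (Real.exp_nat_mul s k).symm
      _ ≤ Real.exp 1 := by
          rw [← hNs]; gcongr
  -- Each step gives up radius `s` and adds an error `C s²`; the growth of `C` stays below `(1 +
  -- s)^N ≤ e`.
  have key : ∀ k ≤ N, ∀ x, ‖x‖ ≤ 1 - k * s →
      ‖(GleasonParts.eulerStep s)^[k] F 0 x‖ ≤ M + k * (Real.exp 1 * C * s ^ 2) := by
    intro k
    induction k with
    | zero => intro _ x hx; simpa using hM x (by simpa using hx)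
    | succ k ih =>
      intro hk x hx
      have hk' : k ≤ N := by lia
      have hkN : ((k : ℝ) + 1) * s ≤ 1 := by
        refine le_of_le_of_eq ?_ hNs
        exact mul_le_mul_of_nonneg_right (by exact_mod_cast hk) hs.le
      rw [Function.iterate_succ_apply']
      push_cast at hx ⊢
      have h1 := (h.iterate_eulerStep hs.le k).norm_eulerStep_le hz (r := 1 - (k + 1) * s)
        (B := M + k * (Real.exp 1 * C * s ^ 2)) (by positivity) hs (by linarith)
        (by nlinarith [Nat.cast_nonneg (α := ℝ) k]) (fun x hx => ih hk' x (by linarith)) hx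
      have h2 : (1 + s) ^ k * C * s ^ 2 ≤ Real.exp 1 * C * s ^ 2 := by
        gcongr; exact hpow k hk'
      linarith
  have hfin := key N le_rfl 0 (by rw [hNs]; simp)
  calc _ ≤ _ := hfin
    _ = M + Real.exp 1 * C * s * (N * s) := by ring
    _ = _ := by rw [hNs, mul_one]

-- Binomial expansion of `(1 + sD)^k` at `0`, where only `D^m` contributes.
omit [NormedSpace ℂ X] in
theorem iterate_eulerStep_zero {F : ℕ → X → ℂ} {m : ℕ} (hF : ∀ j, j ≠ m → F j 0 = 0) (s : ℝ)
    (k : ℕ) : (∀ i j, j + i = m → (eulerStep s)^[k] F j 0 = k.choose i * s ^ i * F m 0) ∧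
      ∀ j, m < j → (eulerStep s)^[k] F j 0 = 0 := by
  induction k with
  | zero =>
    refine ⟨fun i j hij => ?_, fun j hj => hF j hj.ne'⟩
    rcases i with _ | i
    · simp [← hij]
    · simp [hF j (by lia)]
  | succ k ih =>
    rw [Function.iterate_succ_apply']
    refine ⟨fun i j hij => ?_, fun j hj => ?_⟩
    · rcases i with _ | i
      · rw [eulerStep, ih.1 0 j hij, ih.2 (j + 1) (by lia)]
        simp
      · rw [eulerStep, ih.1 (i + 1) j hij, ih.1 i (j + 1) (by lia), Nat.choose_succ_succ]
        push_cast
        ring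
    · rw [eulerStep, ih.2 j hj, ih.2 (j + 1) (by lia)]
      simp

theorem tendsto_choose_mul_inv_pow (m : ℕ) :
    Filter.Tendsto (fun N : ℕ => (N.choose m : ℝ) * (1 / N) ^ m) Filter.atTop
      (nhds (m.factorial : ℝ)⁻¹) := by
  have h := (isEquivalent_choose m).mul
    (Asymptotics.IsEquivalent.refl (u := fun N : ℕ => (1 / N : ℝ) ^ m) (l := Filter.atTop))
  refine h.symm.tendsto_nhds (tendsto_const_nhds.congr' ?_)
  filter_upwards [Filter.eventually_gt_atTop 0] with N hN
  have hN' : (N : ℝ) ≠ 0 := by exact_mod_cast hN.ne'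
  simp only [Pi.mul_apply]
  rw [one_div, inv_pow]
  field_simp

theorem IsDerivSeq.norm_le_of_homogeneous {z : Bidual X} (hz : ‖z‖ ≤ 1) {C M : ℝ}
    {F : ℕ → X → ℂ} (h : IsDerivSeq z C F) (hC : 0 ≤ C) (hM : ∀ x, ‖x‖ ≤ 1 → ‖F 0 x‖ ≤ M)
    {m : ℕ} (hF : ∀ j, j ≠ m → F j 0 = 0) : (m.factorial : ℝ)⁻¹ * ‖F m 0‖ ≤ M := by
  have h1 : Filter.Tendsto (fun N : ℕ => (N.choose m : ℝ) * (1 / N) ^ m * ‖F m 0‖) Filter.atTop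
      (nhds ((m.factorial : ℝ)⁻¹ * ‖F m 0‖)) := (tendsto_choose_mul_inv_pow m).mul_const _
  have h2 : Filter.Tendsto (fun N : ℕ => M + Real.exp 1 * C * (1 / N : ℝ)) Filter.atTop
      (nhds M) := by
    simpa using (tendsto_one_div_atTop_nhds_zero_nat (𝕜 := ℝ)).const_mul (Real.exp 1 * C)
      |>.const_add M
  refine le_of_tendsto_of_tendsto h1 h2 ?_
  filter_upwards [Filter.eventually_gt_atTop 0] with N hN
  have h3 := h.norm_iterate_eulerStep_le hz hC hM hN
  rw [(iterate_eulerStep_zero hF (1 / N) N).1 m 0 (by simp)] at h3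
  simpa using h3

/-- Two Cauchy estimates of radius `1` go from the ball of radius `4` to that of radius `2`, which
contains `x + v`; each doubles the bound. -/
theorem norm_taylor_remainder_le {f : X → ℂ} (hf : AnalyticOnNhd ℂ f univ) {B : ℝ}
    (hB : ∀ x, ‖x‖ < 4 → ‖f x‖ ≤ B) {x v : X} (hx : ‖x‖ ≤ 1) (hv : ‖v‖ ≤ 1) :
    ‖f (x + v) - f x - fderiv ℂ f x v‖ ≤ 4 * B * ‖v‖ ^ 2 := by
  have h1 : ∀ y, ‖y‖ < 3 → ‖fderiv ℂ f y‖ ≤ 2 * B := fun y hy => by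
    simpa using norm_fderiv_le_of_forall_mem_ball one_pos
      (hf.differentiableOn.mono (subset_univ (ball y 1))) fun w hw => hB w (by
        have := norm_le_norm_add_norm_sub' w y
        rw [mem_ball, dist_eq_norm] at hw
        linarith)
  have h2 : ∀ y, ‖y‖ ≤ 2 → ‖fderiv ℂ (fderiv ℂ f) y‖ ≤ 4 * B := fun y hy => by
    have := norm_fderiv_le_of_forall_mem_ball one_pos
      (hf.fderiv.differentiableOn.mono (subset_univ (ball y 1))) fun w hw => h1 w (by
        have := norm_le_norm_add_norm_sub' w y
        rw [mem_ball, dist_eq_norm] at hw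
        linarith)
    linarith
  have hball : ∀ y ∈ closedBall x ‖v‖, ‖y‖ ≤ 2 := fun y hy => by
    have := norm_le_norm_add_norm_sub' y x
    rw [mem_closedBall, dist_eq_norm] at hy
    linarith
  have hB0 : 0 ≤ B := (norm_nonneg _).trans (hB 0 (by simp))
  have hx' : x ∈ closedBall x ‖v‖ := mem_closedBall_self (norm_nonneg v)
  have h3 : ∀ y ∈ closedBall x ‖v‖, ‖fderiv ℂ f y - fderiv ℂ f x‖ ≤ 4 * B * ‖v‖ := fun y hy =>
    ((convex_closedBall x ‖v‖).norm_image_sub_le_of_norm_fderiv_le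
      (fun w _ => (hf.fderiv w (mem_univ w)).differentiableAt) (fun w hw => h2 w (hball w hw))
      hx' hy).trans (by rw [mem_closedBall, dist_eq_norm] at hy; gcongr)
  have h4 := (convex_closedBall x ‖v‖).norm_image_sub_le_of_norm_fderiv_le'
    (fun w _ => (hf w (mem_univ w)).differentiableAt) h3 hx' (y := x + v) (by simp)
  simpa [pow_two, mul_assoc] using h4

/-- The homogeneous polynomial of a continuous multilinear form is entire. -/
theorem analyticOnNhd_diag {m : ℕ} (A : ContinuousMultilinearMap ℂ (fun _ : Fin m => X) ℂ) :
    AnalyticOnNhd ℂ (fun x : X => A fun _ => x) univ := fun _ _ =>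
  (A.contDiff.comp (contDiff_pi.2 fun _ => contDiff_id) :
    ContDiff ℂ ⊤ fun x : X => A fun _ => x).contDiffAt.analyticAt

theorem norm_iteratedFDeriv_diag_le {m : ℕ}
    (A : ContinuousMultilinearMap ℂ (fun _ : Fin m => X) ℂ) (j : ℕ) (x : X) :
    ‖iteratedFDeriv ℂ j (fun x : X => A fun _ => x) x‖
      ≤ m.descFactorial j * ‖A‖ * ‖x‖ ^ (m - j) := by
  let d : X →L[ℂ] (Fin m → X) := ContinuousLinearMap.pi fun _ => ContinuousLinearMap.id ℂ X
  have hd : ‖d‖ ≤ 1 := d.opNorm_le_bound zero_le_one fun y => by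
    rw [one_mul]
    exact pi_norm_const_le y
  have hcomp := d.iteratedFDeriv_comp_right (f := A) (n := ⊤) A.contDiff x (i := j) le_top
  have hA := A.norm_iteratedFDeriv_le j (d x)
  rw [Fintype.card_fin] at hA
  change ‖iteratedFDeriv ℂ j (A ∘ d) x‖ ≤ _
  rw [hcomp]
  refine (ContinuousMultilinearMap.norm_compContinuousLinearMap_le _ _).trans ?_
  rw [Finset.prod_const]
  calc _ ≤ ‖iteratedFDeriv ℂ j A (d x)‖ :=
        mul_le_of_le_one_right (norm_nonneg _) (pow_le_one₀ (norm_nonneg _) hd)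
    _ ≤ _ := hA.trans (by gcongr; exact pi_norm_const_le x)

/-- Below degree `m` the derivative estimate has a positive power of `‖0‖`; above it the falling
factorial vanishes. -/
theorem bidualDeriv_diag_zero {m : ℕ} (A : ContinuousMultilinearMap ℂ (fun _ : Fin m => X) ℂ)
    (z : Bidual X) {j : ℕ} (hj : j ≠ m) : bidualDeriv z j (fun x => A fun _ => x) 0 = 0 := by
  have h := norm_iteratedFDeriv_diag_le A j 0
  have h0 : (m.descFactorial j : ℝ) * ‖A‖ * ‖(0 : X)‖ ^ (m - j) = 0 := by
    rcases lt_or_gt_of_ne hj with h | h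
    · rw [norm_zero, zero_pow (by lia), mul_zero]
    · rw [Nat.descFactorial_of_lt h]; simp
  rw [h0] at h
  rw [bidualDeriv, norm_le_zero_iff.1 h, map_zero]

theorem exists_isDerivSeq_diag {m : ℕ} (A : ContinuousMultilinearMap ℂ (fun _ : Fin m => X) ℂ)
    (z : Bidual X) :
    ∃ C, 0 ≤ C ∧ IsDerivSeq z C fun j => bidualDeriv z j fun x => A fun _ => x := by
  have hP := analyticOnNhd_diag A
  have han : ∀ j, AnalyticOnNhd ℂ (bidualDeriv z j fun x => A fun _ => x) univ := fun j =>
    (aronBernerDiag z j).comp_analyticOnNhd (hP.iteratedFDeriv j)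
  let b : ℕ → ℝ := fun j => ‖aronBernerDiag z j‖ * (m.descFactorial j * ‖A‖ * 4 ^ (m - j))
  have hb0 : ∀ j, 0 ≤ b j := fun j => by positivity
  have hb : ∀ j x, ‖x‖ < 4 → ‖bidualDeriv z j (fun x => A fun _ => x) x‖ ≤ b j := fun j x hx =>
    (aronBernerDiag z j).le_of_opNorm_le_of_le le_rfl
      ((norm_iteratedFDeriv_diag_le A j x).trans (by gcongr))
  have hbB : ∀ j, b j ≤ ∑ i ∈ Finset.range (m + 1), b i := fun j => by
    rcases lt_or_ge m j with h | h
    · have : b j = 0 := by simp [b, Nat.descFactorial_of_lt h]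
      rw [this]
      exact Finset.sum_nonneg fun i _ => hb0 i
    · exact Finset.single_le_sum (fun i _ => hb0 i) (Finset.mem_range.2 (by lia))
  exact ⟨4 * ∑ i ∈ Finset.range (m + 1), b i,
    mul_nonneg (by norm_num) (Finset.sum_nonneg fun i _ => hb0 i),
    fun j x => (han j x (mem_univ x)).differentiableAt,
    fun j x => (bidualDeriv_succ z j (hP x (mem_univ x))).symm,
    fun j x v hx hv => norm_taylor_remainder_le (han j)
      (fun y hy => (hb j y hy).trans (hbB j)) hx hv⟩

/-- The Aron-Berner extension does not increase the norm of a homogeneous polynomial. -/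
theorem norm_aronBernerDiag_le {m : ℕ} (A : ContinuousMultilinearMap ℂ (fun _ : Fin m => X) ℂ)
    (hsymm : ∀ (σ : Equiv.Perm (Fin m)) (v : Fin m → X), (A fun i => v (σ i)) = A v) {M : ℝ}
    (hM : ∀ x, ‖x‖ ≤ 1 → ‖A fun _ => x‖ ≤ M) {z : Bidual X} (hz : ‖z‖ ≤ 1) :
    ‖aronBernerDiag z m A‖ ≤ M := by
  obtain ⟨C, hC, h⟩ := exists_isDerivSeq_diag A z
  have h1 := h.norm_le_of_homogeneous hz hC hM fun j hj => bidualDeriv_diag_zero A z hj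
  -- Symmetry enters here: the derivative sums `A` over all permutations of its arguments.
  have h2 : iteratedFDeriv ℂ m (fun x : X => A fun _ => x) 0 = (m.factorial : ℂ) • A := by
    ext v
    rw [A.iteratedFDeriv_comp_diagonal, Finset.sum_congr rfl fun σ _ => hsymm σ v]
    simp [Fintype.card_perm]
  have h0 : (m.factorial : ℝ) ≠ 0 := by exact_mod_cast m.factorial_ne_zero
  rwa [bidualDeriv, h2, map_smul, norm_smul, Complex.norm_natCast, inv_mul_cancel_left₀ h0] at h1

theorem norm_taylorExt_le_of_norm_le_one (f : HInfty X) {z : Bidual X} (hz : ‖z‖ ≤ 1) (m : ℕ) :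
    ‖taylorExt f z m‖ ≤ ‖f‖ := by
  have hf0 := HInfty.analyticAt_zeroExt f
  refine norm_aronBernerDiag_le _ (fun σ v => ?_) (fun x hx => ?_) hz
  · have := (hf0.contDiffAt (n := ⊤)).iteratedFDeriv_comp_perm v σ
    exact congrArg (fun c => (m.factorial : ℂ)⁻¹ • c) this
  -- Cauchy's estimate on the circle of radius `r` in the direction `x`; then `r → 1`.
  · have key : ∀ r ∈ Ioo (0 : ℝ) 1,
        ‖((m.factorial : ℂ)⁻¹ • iteratedFDeriv ℂ m (zeroExt f.1) 0) fun _ => x‖ ≤ ‖f‖ / r ^ m := by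
      intro r hr
      have hmem : ∀ ζ ∈ closedBall (0 : ℂ) r, (0 : X) + ζ • x ∈ UnitBall X := fun ζ hζ => by
        rw [mem_closedBall_zero_iff] at hζ
        rw [zero_add, mem_ball_zero_iff, norm_smul]
        exact (mul_le_of_le_one_right (norm_nonneg ζ) hx).trans_lt (hζ.trans_lt hr.2)
      have hd : DiffContOnCl ℂ (fun ζ : ℂ => zeroExt f.1 (0 + ζ • x)) (ball 0 r) :=
        DifferentiableOn.diffContOnCl_ball (U := closedBall 0 r)
          ((differentiableOn_comp_line f.2.differentiableOn 0 x).mono hmem) subset_rfl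
      have h1 := Complex.norm_iteratedDeriv_le_of_forall_mem_sphere_norm_le (C := ‖f‖) m hr.1 hd
        fun ζ hζ => by
          rw [zeroExt_apply f.1 (hmem ζ (sphere_subset_closedBall hζ))]
          exact HInfty.norm_apply_le f _
      have h0 := hmem 0 (mem_closedBall_self hr.1.le)
      rw [iteratedDeriv_comp_line isOpen_ball f.2 0 x m 0 h0, zero_smul, zero_add] at h1
      have hm : (0 : ℝ) < m.factorial := by exact_mod_cast m.factorial_pos
      rw [_root_.smul_apply, norm_smul, norm_inv, Complex.norm_natCast, inv_mul_le_iff₀ hm]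
      exact h1.trans_eq (by ring)
    have hlim : ∀ a : ℝ, Filter.Tendsto (fun r : ℝ => a / r ^ m) (nhdsWithin 1 (Iio 1))
        (nhds a) := fun a => by
      have : ContinuousAt (fun r : ℝ => a / r ^ m) 1 :=
        ContinuousAt.div (by fun_prop) (by fun_prop) (by simp)
      simpa using this.tendsto.mono_left nhdsWithin_le_nhds
    refine ge_of_tendsto (hlim ‖f‖) ?_
    filter_upwards [Ioo_mem_nhdsLT (zero_lt_one' ℝ)] with r hr using key r hr

theorem exists_norm_le_one_smul_eq {E : Type*} [NormedAddCommGroup E] [NormedSpace ℂ E] (z : E) :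
    ∃ (w : E) (t : ℝ), ‖w‖ ≤ 1 ∧ t = ‖z‖ ∧ 0 ≤ t ∧ z = (t : ℂ) • w := by
  rcases eq_or_ne z 0 with rfl | hz
  · exact ⟨0, 0, by simp, by simp, le_rfl, by simp⟩
  · have h : (‖z‖ : ℂ) ≠ 0 := by simpa using hz
    exact ⟨(‖z‖ : ℂ)⁻¹ • z, ‖z‖, by simp [norm_smul, hz], rfl, norm_nonneg z,
      (smul_inv_smul₀ h z).symm⟩

theorem norm_taylorExt_le (f : HInfty X) (z : Bidual X) (m : ℕ) :
    ‖taylorExt f z m‖ ≤ ‖f‖ * ‖z‖ ^ m := by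
  obtain ⟨w, t, hw, ht, ht0, hzw⟩ := exists_norm_le_one_smul_eq z
  have h1 : ‖taylorExt f z m‖ = t ^ m * ‖taylorExt f w m‖ := by
    conv_lhs => rw [hzw, taylorExt_smul_bidual]
    rw [norm_mul, norm_pow, Complex.norm_real, Real.norm_of_nonneg ht0]
  rw [← ht]
  rw [h1, mul_comm]
  gcongr
  exact norm_taylorExt_le_of_norm_le_one f hw m

end AronBernerNorm

/-! ### The canonical extension and composition homomorphisms -/

section CanonicalExt

variable {X Y : Type*} [NormedAddCommGroup X] [NormedSpace ℂ X]
  [NormedAddCommGroup Y] [NormedSpace ℂ Y]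

theorem mem_ball_zero_bidual {z : Bidual X} {r : ℝ} : z ∈ ball (0 : Bidual X) r ↔ ‖z‖ < r :=
  mem_ball_zero_iff (E := Bidual X)

/-- The canonical extension of `f` to the ball of the bidual. -/
def canonicalExt (f : HInfty X) (z : Bidual X) : ℂ := ∑' m, taylorExt f z m

theorem summable_norm_taylorExt (f : HInfty X) {z : Bidual X} (hz : ‖z‖ < 1) :
    Summable fun m => ‖taylorExt f z m‖ :=
  Summable.of_nonneg_of_le (fun _ => norm_nonneg _) (norm_taylorExt_le f z)
    ((summable_geometric_of_lt_one (norm_nonneg z) hz).mul_left ‖f‖)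

theorem isCanonicalExtValue_canonicalExt (f : HInfty X) {z : Bidual X} (hz : ‖z‖ < 1) :
    IsCanonicalExtValue f z (canonicalExt f z) :=
  (summable_norm_taylorExt f hz).of_norm.hasSum

theorem analyticOnNhd_canonicalExt (f : HInfty X) :
    AnalyticOnNhd ℂ (canonicalExt f) (ball (0 : Bidual X) 1) := by
  intro z₀ hz₀
  have hz₀' : ‖z₀‖ < 1 := mem_ball_zero_bidual.1 hz₀
  have hρ : (1 + ‖z₀‖) / 2 < 1 := by linarith
  have hρ0 : 0 ≤ (1 + ‖z₀‖) / 2 := by linarith [norm_nonneg z₀]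
  -- Going half the distance to the unit sphere keeps the dominating geometric ratio `(1 + ‖z₀‖) /
  -- 2` below `1`.
  refine analyticAt_tsum (a := fun m => ‖f‖ * ((1 + ‖z₀‖) / 2) ^ m) (r := (1 - ‖z₀‖) / 2)
    (by linarith) (fun m z _ => analyticAt_aronBernerDiag m _ z)
    ((summable_geometric_of_lt_one hρ0 hρ).mul_left _) fun m z hz => ?_
  refine (norm_taylorExt_le f z m).trans ?_
  have h1 : ‖z‖ ≤ (1 + ‖z₀‖) / 2 := by
    have h := norm_le_norm_add_norm_sub' z z₀
    have h2 : ‖z - z₀‖ < (1 - ‖z₀‖) / 2 := by rwa [mem_ball, dist_eq_norm] at hz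
    linarith
  exact mul_le_mul_of_nonneg_left (pow_le_pow_left₀ (norm_nonneg z) h1 m) (norm_nonneg f)

theorem canonicalExt_zero_right (f : HInfty X) :
    canonicalExt f 0 = f.1 ⟨0, mem_ball_self one_pos⟩ := by
  rw [← taylorExt_zero_right f 0]
  refine tsum_eq_single 0 fun m hm => ?_
  have h : taylorExt f ((0 : ℂ) • (0 : Bidual X)) m = 0 := by
    rw [taylorExt_smul_bidual, zero_pow hm, zero_mul]
  rwa [zero_smul ℂ (0 : Bidual X)] at h

theorem taylorExt_algebraMap (c : ℂ) (z : Bidual X) {m : ℕ} (hm : m ≠ 0) :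
    taylorExt (algebraMap ℂ (HInfty X) c) z m = 0 := by
  have hev : zeroExt (algebraMap ℂ (HInfty X) c).1 =ᶠ[nhds (0 : X)] fun _ => c := by
    filter_upwards [isOpen_ball.mem_nhds (mem_ball_self one_pos)] with x hx
    rw [zeroExt_apply _ hx]
    rfl
  rw [taylorExt, (hev.iteratedFDeriv ℂ m).eq_of_nhds, iteratedFDeriv_const_of_ne hm]
  simp

theorem canonicalExt_algebraMap (c : ℂ) (z : Bidual X) :
    canonicalExt (algebraMap ℂ (HInfty X) c) z = c := by
  rw [canonicalExt, tsum_eq_single 0 fun m hm => taylorExt_algebraMap c z hm,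
    taylorExt_zero_right]
  rfl

/-- Evaluation of the canonical extension at a point of the open ball of the bidual. -/
def canonicalExtHom (z : Bidual X) (hz : ‖z‖ < 1) : HInfty X →ₐ[ℂ] ℂ where
  toFun f := canonicalExt f z
  map_one' := by
    rw [← map_one (algebraMap ℂ (HInfty X)), canonicalExt_algebraMap]
  map_mul' f g := by
    simp only [canonicalExt, taylorExt_mul]
    exact (tsum_mul_tsum_eq_tsum_sum_antidiagonal_of_summable_norm
      (summable_norm_taylorExt f hz) (summable_norm_taylorExt g hz)).symm
  map_zero' := by
    rw [← map_zero (algebraMap ℂ (HInfty X)), canonicalExt_algebraMap]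
  map_add' f g := by
    simp only [canonicalExt, taylorExt_add]
    exact (summable_norm_taylorExt f hz).of_norm.tsum_add (summable_norm_taylorExt g hz).of_norm
  commutes' c := canonicalExt_algebraMap c z

/-- Summing the bounds on the Taylor terms would give only `‖f‖ / (1 - ‖z‖)`; multiplicativity
removes the loss. -/
theorem norm_canonicalExt_le (f : HInfty X) {z : Bidual X} (hz : ‖z‖ < 1) :
    ‖canonicalExt f z‖ ≤ ‖f‖ :=
  HInfty.norm_algHom_le (canonicalExtHom z hz) f

/-- The Schwarz lemma for the canonical extension. -/
theorem norm_canonicalExt_sub_le (f : HInfty X) {M : ℝ}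
    (hM : ∀ x, ‖f.1 x - f.1 ⟨0, mem_ball_self one_pos⟩‖ ≤ M) {z : Bidual X} (hz : ‖z‖ < 1) :
    ‖canonicalExt f z - f.1 ⟨0, mem_ball_self one_pos⟩‖ ≤ M * ‖z‖ := by
  set c := f.1 ⟨0, mem_ball_self one_pos⟩ with hc
  have hM0 : 0 ≤ M := (norm_nonneg _).trans (hM ⟨0, mem_ball_self one_pos⟩)
  have hfc : ‖f - algebraMap ℂ (HInfty X) c‖ ≤ M := HInfty.norm_le hM0 hM
  have hmaps : MapsTo (canonicalExt f) (ball 0 1) (closedBall (canonicalExt f 0) M) := by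
    intro w hw
    have hw' : ‖w‖ < 1 := mem_ball_zero_bidual.1 hw
    rw [canonicalExt_zero_right, mem_closedBall, dist_eq_norm]
    have h := HInfty.norm_algHom_le (canonicalExtHom w hw') (f - algebraMap ℂ (HInfty X) c)
    rw [map_sub, AlgHom.commutes] at h
    exact h.trans hfc
  have h := Complex.dist_le_div_mul_dist_of_mapsTo_ball
    (analyticOnNhd_canonicalExt f).differentiableOn hmaps (z := z) (mem_ball_zero_bidual.2 hz)
  rw [canonicalExt_zero_right, dist_eq_norm] at h
  refine h.trans_eq ?_
  rw [div_one]
  congr 1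
  exact dist_zero_right z

theorem bidualDeriv_dualToHInfty (l : StrongDual ℂ X) (z : Bidual X) :
    ∀ x ∈ UnitBall X, bidualDeriv z 1 (zeroExt (dualToHInfty l).1) x = z l := by
  intro x hx
  have hev : bidualDeriv z 0 (zeroExt (dualToHInfty l).1) =ᶠ[nhds x] l := by
    filter_upwards [isOpen_ball.mem_nhds hx] with y hy
    rw [bidualDeriv_zero, zeroExt_apply _ hy]
    rfl
  rw [bidualDeriv_succ z 0 ((dualToHInfty l).2 x hx), hev.fderiv_eq, l.fderiv]

theorem bidualDeriv_dualToHInfty_add_two (l : StrongDual ℂ X) (z : Bidual X) (n : ℕ) :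
    ∀ x ∈ UnitBall X, bidualDeriv z (n + 2) (zeroExt (dualToHInfty l).1) x = 0 := by
  have h : ∀ (k : ℕ) (c : ℂ),
      (∀ x ∈ UnitBall X, bidualDeriv z k (zeroExt (dualToHInfty l).1) x = c) →
      ∀ x ∈ UnitBall X, bidualDeriv z (k + 1) (zeroExt (dualToHInfty l).1) x = 0 := by
    intro k c hk x hx
    have hev : bidualDeriv z k (zeroExt (dualToHInfty l).1) =ᶠ[nhds x] fun _ => c := by
      filter_upwards [isOpen_ball.mem_nhds hx] with y hy using hk y hy
    rw [bidualDeriv_succ z k ((dualToHInfty l).2 x hx), hev.fderiv_eq, fderiv_const_apply,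
      map_zero]
  induction n with
  | zero => exact h 1 (z l) (bidualDeriv_dualToHInfty l z)
  | succ n ih => exact h (n + 2) 0 ih

theorem canonicalExt_dualToHInfty (l : StrongDual ℂ X) (z : Bidual X) :
    canonicalExt (dualToHInfty l) z = z l := by
  have h0 := mem_ball_self (x := (0 : X)) one_pos
  rw [canonicalExt, tsum_eq_single 1, taylorExt_eq_bidualDeriv, bidualDeriv_dualToHInfty l z 0 h0]
  · simp
  · intro m hm
    rcases m with _ | _ | m
    · rw [taylorExt_zero_right]
      exact l.map_zero
    · exact absurd rfl hm
    · rw [taylorExt_eq_bidualDeriv, bidualDeriv_dualToHInfty_add_two l z m 0 h0, mul_zero]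

/-- The function `f̃ ∘ g`. -/
def canonicalExtComp (g : HInftyVec Y (Bidual X)) (hg : ∀ y, ‖g.1 y‖ < 1) (f : HInfty X) :
    HInfty Y :=
  ⟨BoundedContinuousFunction.ofNormedAddCommGroup (fun y => canonicalExt f (g.1 y))
      (by
        have h := (analyticOnNhd_canonicalExt f).continuousOn
        exact h.comp_continuous g.1.continuous fun y => mem_ball_zero_bidual.2 (hg y))
      ‖f‖ fun y => norm_canonicalExt_le f (hg y),
    isHolomorphic_of_eqOn (F := fun y => canonicalExt f (zeroExt g.1 y))
      (fun y hy => by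
        refine AnalyticAt.fun_comp (g := canonicalExt f) ?_ (g.2 y hy)
        refine analyticOnNhd_canonicalExt f _ (mem_ball_zero_bidual.2 ?_)
        rw [zeroExt_apply _ hy]
        exact hg _)
      fun y => (congrArg (canonicalExt f) (zeroExt_apply g.1 y.2)).symm⟩

/-- The composition homomorphism `C_g`. -/
def compositionHom (g : HInftyVec Y (Bidual X)) (hg : ∀ y, ‖g.1 y‖ < 1) : VectorSpectrum X Y :=
  ⟨{ toFun := canonicalExtComp g hg
     map_smul' := fun c f => HInfty.ext fun y =>
       HInfty.algHom_smul (canonicalExtHom (g.1 y) (hg y)) c f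
     map_zero' := HInfty.ext fun y => (canonicalExtHom (g.1 y) (hg y)).map_zero'
     map_add' := fun f k => HInfty.ext fun y => (canonicalExtHom (g.1 y) (hg y)).map_add' f k
     map_mul' := fun f k => HInfty.ext fun y => (canonicalExtHom (g.1 y) (hg y)).map_mul' f k },
    fun h => by
      let y₀ : UnitBall Y := ⟨0, mem_ball_self one_pos⟩
      have h1 : (canonicalExtComp g hg 1).1 y₀ = 0 :=
        congrArg (fun Φ : HInfty X →ₙₐ[ℂ] HInfty Y => (Φ 1).1 y₀) h
      exact one_ne_zero ((map_one (canonicalExtHom (g.1 y₀) (hg y₀))).symm.trans h1)⟩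

theorem compositionHom_val (g : HInftyVec Y (Bidual X)) (hg : ∀ y, ‖g.1 y‖ < 1) (f : HInfty X)
    (y : UnitBall Y) : (compositionHom g hg).val f y = canonicalExt f (g.1 y) := rfl

theorem isCompositionHom_compositionHom (g : HInftyVec Y (Bidual X)) (hg : ∀ y, ‖g.1 y‖ < 1) :
    IsCompositionHom g (compositionHom g hg) := fun f y =>
  isCanonicalExtValue_canonicalExt f (hg y)

theorem HInftyVec.norm_apply_le {E : Type*} [NormedAddCommGroup E] [NormedSpace ℂ E]
    (g : HInftyVec Y E) (y : UnitBall Y) : ‖g.1 y‖ ≤ ‖g‖ :=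
  g.1.norm_coe_le_norm y

theorem HInftyVec.norm_zero_apply_lt (y : UnitBall Y) :
    ‖(0 : HInftyVec Y (Bidual X)).1 y‖ < 1 :=
  (norm_zero (E := Bidual X)).trans_lt one_pos

theorem compositionHom_zero_val (f : HInfty X) (y : UnitBall Y) :
    (compositionHom (0 : HInftyVec Y (Bidual X)) HInftyVec.norm_zero_apply_lt).val f y
      = f.1 ⟨0, mem_ball_self one_pos⟩ :=
  canonicalExt_zero_right f

theorem compositionHom_mem_gleasonPart (g : HInftyVec Y (Bidual X)) (hg : ∀ y, ‖g.1 y‖ < 1)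
    (hg1 : ‖g‖ < 1) : compositionHom g hg ∈ gleasonPart
      (compositionHom (0 : HInftyVec Y (Bidual X)) HInftyVec.norm_zero_apply_lt) := by
  have h : gleasonDist (compositionHom (0 : HInftyVec Y (Bidual X)) HInftyVec.norm_zero_apply_lt)
      (compositionHom g hg) ≤ ENNReal.ofReal (2 * ‖g‖) := by
    refine iSup₂_le fun f hf => ?_
    rw [← ofReal_norm]
    refine ENNReal.ofReal_le_ofReal (HInfty.norm_le (by positivity) fun y => ?_)
    change ‖VectorSpectrum.val _ f y - VectorSpectrum.val _ f y‖ ≤ _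
    rw [compositionHom_zero_val, compositionHom_val, norm_sub_rev]
    -- For `‖f‖ ≤ 1` the oscillation about `f(0)` is at most `2`.
    have h1 := norm_canonicalExt_sub_le f (M := 2) (fun x => (norm_sub_le _ _).trans (by
      have h2 := HInfty.norm_apply_le f x
      have h3 := HInfty.norm_apply_le f ⟨0, mem_ball_self one_pos⟩
      linarith)) (hg y)
    exact h1.trans (mul_le_mul_of_nonneg_left (HInftyVec.norm_apply_le g y) zero_le_two)
  refine h.trans_lt ?_
  rw [ENNReal.ofReal_lt_iff_lt_toReal (by positivity) ENNReal.ofNat_ne_top]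
  simp only [ENNReal.toReal_ofNat]
  linarith

theorem sigmaDist_compositionHom (g : HInftyVec Y (Bidual X)) (hg : ∀ y, ‖g.1 y‖ < 1) :
    sigmaDist (compositionHom g hg)
        (compositionHom (0 : HInftyVec Y (Bidual X)) HInftyVec.norm_zero_apply_lt)
      = ENNReal.ofReal ‖g‖ := by
  set S := sigmaDist (compositionHom g hg)
    (compositionHom (0 : HInftyVec Y (Bidual X)) HInftyVec.norm_zero_apply_lt) with hS
  have hle : S ≤ ENNReal.ofReal ‖g‖ := by
    refine iSup_le fun y => iSup₂_le fun f hf => iSup_le fun hf0 => ?_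
    replace hf0 := (compositionHom_zero_val f y).symm.trans hf0
    change ‖(compositionHom g hg).val f y‖ₑ ≤ _
    rw [← ofReal_norm, compositionHom_val]
    refine ENNReal.ofReal_le_ofReal ?_
    -- The constraint `f(0) = 0` improves the Schwarz constant from `2` to `1`.
    have h1 := norm_canonicalExt_sub_le f (M := 1) (fun x => by
      rw [hf0, sub_zero]
      exact (HInfty.norm_apply_le f x).trans hf) (hg y)
    rw [hf0, sub_zero, one_mul] at h1
    exact h1.trans (HInftyVec.norm_apply_le g y)
  have htop : S ≠ ⊤ := (hle.trans_lt ENNReal.ofReal_lt_top).ne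
  refine hle.antisymm (ENNReal.ofReal_le_of_le_toReal ?_)
  refine (BoundedContinuousFunction.norm_le ENNReal.toReal_nonneg).2 fun y => ?_
  -- Functionals vanish at `0`, so those of norm one are admissible in `σ`, and they recover the
  -- norm of `g(y)`.
  refine (g.1 y).opNorm_le_of_unit_norm ENNReal.toReal_nonneg fun l hl => ?_
  have h0 : (compositionHom (0 : HInftyVec Y (Bidual X)) HInftyVec.norm_zero_apply_lt).val
      (dualToHInfty l) y = 0 := by
    rw [compositionHom_zero_val]
    exact l.map_zero
  have h1 : ‖(compositionHom g hg).val (dualToHInfty l) y‖ₑ ≤ S :=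
    le_iSup_of_le y (le_iSup₂_of_le (dualToHInfty l) ((norm_dualToHInfty_le l).trans hl.le)
      (le_iSup_of_le h0 le_rfl))
  rw [compositionHom_val, canonicalExt_dualToHInfty] at h1
  exact (toReal_enorm _).symm.trans_le (ENNReal.toReal_mono htop h1)

end CanonicalExt

end GleasonParts
end

open GleasonParts in
theorem mainTheorem10 {X Y : Type*}
    [NormedAddCommGroup X] [NormedSpace ℂ X] [CompleteSpace X]
    [NormedAddCommGroup Y] [NormedSpace ℂ Y] [CompleteSpace Y] :
    (∀ g : HInftyVec Y (Bidual X), ‖g‖ < 1 →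
      ∃ Cg C₀ : VectorSpectrum X Y,
        IsCompositionHom g Cg ∧ IsCompositionHom 0 C₀ ∧
        Cg ∈ gleasonPart C₀ ∧ sigmaDist Cg C₀ = ENNReal.ofReal ‖g‖) ∧
    (∀ g h : HInftyVec Y (Bidual X), ‖g‖ = 1 → ‖h‖ < 1 →
      ∀ Φ ∈ fiber g, ∀ Ψ ∈ fiber h, Disjoint (gleasonPart Φ) (gleasonPart Ψ)) ∧
    (∀ g h : HInftyVec Y (Bidual X),
      (∀ y, g.1 y ∈ ball (0 : Bidual X) 1) → (∀ y, h.1 y ∈ sphere (0 : Bidual X) 1) →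
      ∀ Φ ∈ fiber g, ∀ Ψ ∈ fiber h, Disjoint (gleasonPart Φ) (gleasonPart Ψ)) := by
  refine ⟨fun g hg => ?_, fun g h hg hh Φ hΦ Ψ hΨ =>
    disjoint_gleasonPart_of_norm_lt_one hg hh hΦ hΨ, fun g h hg hh Φ hΦ Ψ hΨ => ?_⟩
  · have hg' : ∀ y, ‖g.1 y‖ < 1 := fun y => (HInftyVec.norm_apply_le g y).trans_lt hg
    exact ⟨compositionHom g hg', compositionHom 0 HInftyVec.norm_zero_apply_lt,
      isCompositionHom_compositionHom g hg', isCompositionHom_compositionHom 0 _,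
      compositionHom_mem_gleasonPart g hg' hg, sigmaDist_compositionHom g hg'⟩
  -- A single point suffices in (c); the center of the ball is taken.
  · exact disjoint_gleasonPart_of_ball_of_sphere (y := ⟨0, mem_ball_self one_pos⟩)
      (mem_ball_zero_bidual.1 (hg _)) ((mem_sphere_zero_iff_norm (E := Bidual X)).1 (hh _)) hΦ hΨ
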